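/- Let $G$ be the Cantor dyadic group, i.e. the group of sequences $x=(x_j)_{j\in\mathbb Z}$ with $x_j\in\mathbb Z/2$ and $x_j=0$ for all sufficiently negative $j$, under coordinatewise addition mod $2$, with the topology in which the subgroups $U_l=\{x: x_j=0 \text{ for } j\le l\}$, $l\in\mathbb Z$, form a neighbourhood basis of $0$. Let $D=U_0$, let $\Lambda=\{x\in G: x_j=0\text{ for } j>0\}$, and equip $G$ with the Haar measure normalized so that $D$ has measure $1$. Let $\rho$ be the automorphism $(\rho x)_j=x_{j+1}$, $\sigma=\rho^{-1}$, $\Lambda_1=\rho\Lambda=\{n\in\Lambda: n_0=0\}$, and let $0.1\in G$ be the element whose only non-zero coordinate is the one at index $1$. Identify $G$ with its dual through the characters $\chi(x,\omega)=(-1)^{\sum_j x_j\omega_{1-j}}$, let $\hat f$ denote the Fourier transform on $L^2(G)$, and let $T_nf(x)=f(x-n)$. A frame multiresolution analysis (FMRA) of $L^2(G)$ with scaling function $\varphi$ is a sequence $(V_j)_{j\in\mathbb Z}$ of closed subspaces of $L^2(G)$ such that $V_j\subseteq V_{j+1}$; $f\in V_j$ iff $f(\rho\,\cdot)\in V_{j+1}$;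 $\bigcup_jV_j$ is dense in $L^2(G)$; $\bigcap_jV_j=\{0\}$; $\varphi\in V_0$ and $\{T_n\varphi:n\in\Lambda\}$ is a frame for $V_0$. **Theorem.** Let $(V_j)$ be an FMRA of $L^2(G)$ with scaling function $\varphi$, and let $m\in L^2(D)$ be a $\Lambda$-periodic function on $G$ such that $\hat\varphi(\rho\omega)=m(\omega)\hat\varphi(\omega)$ for a.e. $\omega\in G$. Put $W_0=V_1\ominus V_0$ (the orthogonal complement of $V_0$ in $V_1$) and $$\Delta_2=\Big\{\omega\in D:\ \sum_{n\in\Lambda_1}|\hat\varphi(\sigma(\omega+n))|^2\ne0\ \text{ and }\ \sum_{n\in\Lambda\setminus\Lambda_1}|\hat\varphi(\sigma(\omega+n))|^2\neq0\Big\}.$$ Then there exists $\psi\in W_0$ such that $\{T_n\psi:n\in\Lambda\}$ is a frame for $W_0$ if and only if one of the following equivalent conditions holds: (i) for a.e. $\omega\in\Delta_2$, $m(\sigma\omega)$ and $m(\sigma\omega+0.1)$ are not both zero; (ii) there are positive constants $c,d$ such that $c\le|m(\sigma\omega)|^2+|m(\sigma\omega+0.1)|^2\le d$ for a.e. $\omega\in\Delta_2$.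 Moreover, for every such $\psi$ the system $\{2^{j/2}\psi(\rho^jx-n): j\in\mathbb Z,\ n\in\Lambda\}$ is a frame for $L^2(G)$. -/

import Mathlib

open MeasureTheory Filter Topology
open scoped ENNReal

namespace CantorDyadic

/-! ### The Cantor dyadic group -/

/-- The two-sided binary sequences that vanish at all sufficiently negative indices, as a subgroup
of `ℤ → ZMod 2` under coordinatewise addition mod 2. -/
def sequences : AddSubgroup (ℤ → ZMod 2) where
  carrier := {x | ∃ k : ℤ, ∀ j < k, x j = 0}
  zero_mem' := ⟨0, fun _ _ => rfl⟩
  add_mem' := by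
    rintro x y ⟨k, hk⟩ ⟨l, hl⟩
    refine ⟨min k l, fun j hj => ?_⟩
    simp [hk j (lt_of_lt_of_le hj (min_le_left _ _)), hl j (lt_of_lt_of_le hj (min_le_right _ _))]
  neg_mem' := by
    rintro x ⟨k, hk⟩
    exact ⟨k, fun j hj => by simp [hk j hj]⟩

/-- The Cantor dyadic group `G`. It is a type of its own, so that it does not carry the product
topology of `ℤ → ZMod 2`. -/
def G : Type := sequences

instance : AddCommGroup G := inferInstanceAs (AddCommGroup sequences)

/-- `x j` is the `j`-th coordinate of `x : G`. -/
instance : CoeFun G (fun _ => ℤ → ZMod 2) := ⟨fun x => x.1⟩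

theorem ext_coord {x y : G} (h : ∀ j, x j = y j) : x = y := Subtype.ext (funext h)

@[simp] theorem zero_apply (j : ℤ) : (0 : G) j = 0 := rfl

@[simp] theorem add_apply (x y : G) (j : ℤ) : (x + y) j = x j + y j := rfl

@[simp] theorem neg_apply (x : G) (j : ℤ) : (-x) j = -x j := rfl

/-- The topology of `G`: a basis of neighbourhoods of `x` is given by the sets
`x + U l = {y | y j = x j for all j ≤ l}`, for `l : ℤ`. -/
instance : TopologicalSpace G where
  IsOpen s := ∀ x ∈ s, ∃ l : ℤ, ∀ y : G, (∀ j ≤ l, y j = x j) → y ∈ s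
  isOpen_univ := fun _ _ => ⟨0, fun _ _ => trivial⟩
  isOpen_inter := by
    rintro s t hs ht x ⟨hxs, hxt⟩
    obtain ⟨k, hk⟩ := hs x hxs
    obtain ⟨l, hl⟩ := ht x hxt
    exact ⟨max k l, fun y hy => ⟨hk y fun j hj => hy j (hj.trans (le_max_left _ _)),
      hl y fun j hj => hy j (hj.trans (le_max_right _ _))⟩⟩
  isOpen_sUnion := by
    rintro S hS x ⟨s, hs, hxs⟩
    obtain ⟨l, hl⟩ := hS s hs x hxs
    exact ⟨l, fun y hy => ⟨s, hs, hl y hy⟩⟩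

theorem isOpen_iff {s : Set G} :
    IsOpen s ↔ ∀ x ∈ s, ∃ l : ℤ, ∀ y : G, (∀ j ≤ l, y j = x j) → y ∈ s := Iff.rfl

theorem isOpen_cylinder (x : G) (l : ℤ) : IsOpen {y : G | ∀ j ≤ l, y j = x j} :=
  isOpen_iff.2 fun _ hy => ⟨l, fun _ hz j hj => (hz j hj).trans (hy j hj)⟩

theorem mem_nhds_iff {x : G} {s : Set G} :
    s ∈ 𝓝 x ↔ ∃ l : ℤ, ∀ y : G, (∀ j ≤ l, y j = x j) → y ∈ s := by
  constructor
  · intro h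
    obtain ⟨t, hts, ht, hx⟩ := _root_.mem_nhds_iff.1 h
    obtain ⟨l, hl⟩ := isOpen_iff.1 ht x hx
    exact ⟨l, fun y hy => hts (hl y hy)⟩
  · rintro ⟨l, hl⟩
    exact Filter.mem_of_superset ((isOpen_cylinder x l).mem_nhds fun _ _ => rfl) hl

instance : IsTopologicalAddGroup G where
  continuous_add := by
    refine continuous_def.2 fun s hs => isOpen_iff_mem_nhds.2 ?_
    rintro ⟨x, y⟩ hxy
    obtain ⟨l, hl⟩ := isOpen_iff.1 hs _ hxy
    filter_upwards [prod_mem_nhds ((isOpen_cylinder x l).mem_nhds fun _ _ => rfl)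
      ((isOpen_cylinder y l).mem_nhds fun _ _ => rfl)]
    rintro ⟨a, b⟩ ⟨ha, hb⟩
    exact hl _ fun j hj => congrArg₂ (· + ·) (ha j hj) (hb j hj)
  continuous_neg := by
    refine continuous_def.2 fun s hs => isOpen_iff.2 fun x hx => ?_
    obtain ⟨l, hl⟩ := isOpen_iff.1 hs _ hx
    exact ⟨l, fun y hy => hl _ fun j hj => by simp [hy j hj]⟩

/-- The open subgroup `U l = {x | x j = 0 for j ≤ l}`. -/
def U (l : ℤ) : AddSubgroup G where
  carrier := {x | ∀ j ≤ l, x j = 0}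
  zero_mem' := fun _ _ => rfl
  add_mem' := fun {x y} hx hy j hj => by simp [hx j hj, hy j hj]
  neg_mem' := fun {x} hx j hj => by simp [hx j hj]

/-- The unit interval `D = U 0` of `G`. -/
abbrev D : AddSubgroup G := U 0

/-- The discrete subgroup `Λ` of "integers" of `G`. -/
def Lam : AddSubgroup G where
  carrier := {x | ∀ j > 0, x j = 0}
  zero_mem' := fun _ _ => rfl
  add_mem' := fun {x y} hx hy j hj => by simp [hx j hj, hy j hj]
  neg_mem' := fun {x} hx j hj => by simp [hx j hj]

theorem isOpen_U (l : ℤ) : IsOpen (U l : Set G) := isOpen_cylinder 0 l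

theorem isCompact_U (l : ℤ) : IsCompact (U l : Set G) := by
  classical
  let e : (ℤ → ZMod 2) → G := fun a =>
    ⟨fun j => if j ≤ l then 0 else a j, l, fun j hj => if_pos hj.le⟩
  have he : Continuous e := by
    refine continuous_def.2 fun s hs => isOpen_iff_mem_nhds.2 fun a ha => ?_
    obtain ⟨k, hk⟩ := isOpen_iff.1 hs _ ha
    have hopen : IsOpen (Set.pi (Set.Icc l k) fun j => ({a j} : Set (ZMod 2))) :=
      isOpen_set_pi (Set.finite_Icc l k) fun _ _ => isOpen_discrete _
    filter_upwards [hopen.mem_nhds fun j _ => rfl] with b hb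
    refine hk _ fun j hj => ?_
    change (if j ≤ l then 0 else b j) = (if j ≤ l then 0 else a j)
    split_ifs with h
    · rfl
    · exact hb j ⟨(not_le.1 h).le, hj⟩
  have hrange : (U l : Set G) = Set.range e := by
    ext x
    constructor
    · intro hx
      refine ⟨x.1, ext_coord fun j => ?_⟩
      change (if j ≤ l then 0 else x j) = x j
      split_ifs with h
      · exact (hx j h).symm
      · rfl
    · rintro ⟨a, rfl⟩ j hj
      exact if_pos hj
  rw [hrange]
  exact isCompact_range he

/-- `D` as a compact set with non-empty interior. -/
def unitCompact : TopologicalSpace.PositiveCompacts G where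
  carrier := (D : Set G)
  isCompact' := isCompact_U 0
  interior_nonempty' := ⟨0, (isOpen_U 0).interior_eq.symm ▸ (D).zero_mem⟩

instance : LocallyCompactSpace G := unitCompact.locallyCompactSpace_of_addGroup

instance : MeasurableSpace G := borel G

instance : BorelSpace G := ⟨rfl⟩

/-- `volume` on `G` is the Haar measure for which `D` has measure one. -/
noncomputable instance : MeasureSpace G := ⟨Measure.addHaarMeasure unitCompact⟩

theorem volume_def : (volume : Measure G) = Measure.addHaarMeasure unitCompact := rfl

instance : (volume : Measure G).IsAddHaarMeasure :=
  inferInstanceAs (Measure.addHaarMeasure unitCompact).IsAddHaarMeasure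

instance : (volume : Measure G).Regular :=
  inferInstanceAs (Measure.addHaarMeasure unitCompact).Regular

/-- The automorphism `ρ ^ k` of `G`: `(shift k x) j = x (j + k)`. -/
def shift (k : ℤ) : G ≃ₜ+ G where
  toFun x := ⟨fun j => x (j + k), by
    obtain ⟨l, hl⟩ := x.2
    exact ⟨l - k, fun j hj => hl _ (by omega)⟩⟩
  invFun x := ⟨fun j => x (j - k), by
    obtain ⟨l, hl⟩ := x.2
    exact ⟨l + k, fun j hj => hl _ (by omega)⟩⟩
  left_inv x := ext_coord fun j => congrArg x.1 (by omega)
  right_inv x := ext_coord fun j => congrArg x.1 (by omega)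
  map_add' _ _ := rfl
  continuous_toFun := by
    refine continuous_def.2 fun s hs => isOpen_iff.2 fun x hx => ?_
    obtain ⟨l, hl⟩ := isOpen_iff.1 hs _ hx
    exact ⟨l + k, fun y hy => hl _ fun j hj => hy (j + k) (by omega)⟩
  continuous_invFun := by
    refine continuous_def.2 fun s hs => isOpen_iff.2 fun x hx => ?_
    obtain ⟨l, hl⟩ := isOpen_iff.1 hs _ hx
    exact ⟨l - k, fun y hy => hl _ fun j hj => hy (j - k) (by omega)⟩

/-- The expanding automorphism `ρ`, `(ρ x) j = x (j + 1)`. -/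
abbrev ρ : G ≃ₜ+ G := shift 1

/-- The contracting automorphism `σ = ρ⁻¹`, `(σ x) j = x (j - 1)`. -/
abbrev σ : G ≃ₜ+ G := shift (-1)

/-- The element `0.1` of `G`: its only non-zero coordinate is the one at the index `1`. -/
def pointOne : G :=
  ⟨fun j => if j = 1 then 1 else 0, 1, fun _ hj => if_neg hj.ne⟩

/-! ### The space `L²(G)`, translations and dilations -/

/-- The Hilbert space `L²(G)` of complex functions. -/
abbrev L2 : Type := Lp ℂ 2 (volume : Measure G)

/-- The translation `(T_h f)(x) = f (x - h)`. -/
noncomputable def T (h : G) (f : L2) : L2 :=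
  Lp.compMeasurePreserving (fun x => x - h) (measurePreserving_sub_right volume h) f

theorem map_shift_le (k : ℤ) : ∃ c : ℝ≥0∞, c ≠ ∞ ∧
    Measure.map (shift k) (volume : Measure G) ≤ c • (volume : Measure G) := by
  refine ⟨((addEquivAddHaarChar (shift k))⁻¹ : NNReal), ENNReal.coe_ne_top, ?_⟩
  have h := addEquivAddHaarChar_smul_map (volume : Measure G) (shift k)
  have h0 : addEquivAddHaarChar (shift k) ≠ 0 := (addEquivAddHaarChar_pos _).ne'
  conv_rhs => rw [← h]
  rw [ENNReal.smul_def, smul_smul, ← ENNReal.coe_mul, inv_mul_cancel₀ h0, ENNReal.coe_one, one_smul]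

theorem memLp_comp_shift (k : ℤ) (f : L2) :
    MemLp (fun x => (f : G → ℂ) (shift k x)) 2 (volume : Measure G) := by
  obtain ⟨c, hc, h⟩ := map_shift_le k
  exact ((Lp.memLp f).of_measure_le_smul hc h).comp_of_map
    (shift k).continuous_toFun.measurable.aemeasurable

/-- The composition `x ↦ f (ρ ^ k x)` as an element of `L²(G)`. -/
noncomputable def compShift (k : ℤ) (f : L2) : L2 := (memLp_comp_shift k f).toLp _

/-- The affine system `ψ_{j,n}(x) = 2 ^ (j / 2) ψ (ρ ^ j x - n)`, for `j : ℤ` and `n ∈ Λ`. -/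
noncomputable def affineSystem (ψ : L2) (i : ℤ × Lam) : L2 :=
  (((2 : ℝ) ^ ((i.1 : ℝ) / 2) : ℝ) : ℂ) • compShift i.1 (T i.2 ψ)

/-- The family `f` is a frame for the subspace `W` of `L²(G)`. -/
def IsFrameFor {ι : Type} (f : ι → L2) (W : Submodule ℂ L2) : Prop :=
  (∀ i, f i ∈ W) ∧ ∃ a b : ℝ, 0 < a ∧ a ≤ b ∧ ∀ g ∈ W,
    Summable (fun i => ‖inner ℂ (f i) g‖ ^ 2) ∧
    a * ‖g‖ ^ 2 ≤ ∑' i, ‖inner ℂ (f i) g‖ ^ 2 ∧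
    ∑' i, ‖inner ℂ (f i) g‖ ^ 2 ≤ b * ‖g‖ ^ 2

/-- `V` is a frame multiresolution analysis of `L²(G)` with scaling function `φ`. -/
structure IsFMRA (V : ℤ → Submodule ℂ L2) (φ : L2) : Prop where
  closed : ∀ j, IsClosed (V j : Set L2)
  mono : ∀ j, V j ≤ V (j + 1)
  dilate : ∀ j (f : L2), f ∈ V j ↔ compShift 1 f ∈ V (j + 1)
  dense : Dense (⋃ j, (V j : Set L2))
  inter : ⨅ j, V j = ⊥
  scaling_mem : φ ∈ V 0
  frame : IsFrameFor (fun n : Lam => T n φ) (V 0)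

/-! ### The Fourier transform -/

/-- The characters of `G` (which is its own dual group):
`χ(x, ω) = (-1) ^ (∑ j, x j * ω (1 - j))`. Only finitely many terms of the sum are non-zero. -/
noncomputable def χ (x ω : G) : ℂ := (-1) ^ (∑ᶠ j : ℤ, x j * ω (1 - j)).val

/-- `g` represents the Fourier transform of `f ∈ L²(G)`, that is, `g` is the `L²`-limit of the
integrals `∫ x ∈ K, f x * conj (χ(x, ω))` over the compact sets `K = U (-k)` that exhaust `G`. -/
def IsFourierTransform (f : L2) (g : G → ℂ) : Prop :=
  MemLp g 2 (volume : Measure G) ∧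
  Tendsto (fun k : ℕ => eLpNorm
    (fun ω : G => (∫ x in (U (-(k : ℤ)) : Set G), f x * starRingEnd ℂ (χ x ω)) - g ω)
    2 (volume : Measure G)) atTop (𝓝 0)

/-- The set `Δ₂` of those `ω ∈ D` for which both the sum of `|φ̂ (σ (ω + n))|²` over
`n ∈ Λ₁ = ρ Λ = {n ∈ Λ | n 0 = 0}` and the sum over `n ∈ Λ \ Λ₁` are non-zero. -/
def Delta2 (φhat : G → ℂ) : Set G :=
  {ω | ω ∈ D ∧
    (∑' n : {n : G // n ∈ Lam ∧ n 0 = 0}, ‖φhat (σ (ω + n))‖ₑ ^ 2) ≠ 0 ∧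
    (∑' n : {n : G // n ∈ Lam ∧ n 0 ≠ 0}, ‖φhat (σ (ω + n))‖ₑ ^ 2) ≠ 0}

end CantorDyadic

open CantorDyadic

namespace CantorDyadic

/-! ### Coordinates and the topology of `G` -/

/-! The proof passes to fibres over `D`. The Fourier transform turns translation by `n ∈ Λ` into
multiplication by the `Λ`-periodic character `χ n`, so the scalar products of `g` with the
translates of `f` are the Walsh coefficients on `D` of the bracket `∑ conj f̂(ω+n) ĝ(ω+n)`
(`inner_T`). By Parseval (`hasSum_inner_T`) their square sum is the integral of the squared bracket.
Frame questions thereby become pointwise questions on fibres; in particular the periodization `Φ` of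
`|φ̂|²` takes values a.e. in `{0} ∪ [a, b]` (`ae_eq_zero_or_mem_Icc`).

An element of `V 1` has a periodic symbol `r` with `f̂(ω) = r(σω) φ̂(σω)`. Splitting `Λ` into `Λ₁`
and its other coset shows that its fibre over `ω` is the vector `(r(σω), r(σω+0.1))` with weights `S
= Φ(σω)` and `R = Φ(σω+0.1)`. The fibre of `V 0` is spanned by `(m(σω), m(σω+0.1))`, and that of
`W₀` is its weighted orthogonal complement. A single generator can serve only if this complement has
dimension at most one; dimension two occurs exactly when `S`, `R` are non-zero and both values of
`m` vanish, that is, where (i) fails.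

Necessity (`not_both_zero_of_isFrameFor`): on the exceptional set a vector orthogonal to the fibre
of `ψ` can be chosen measurably, contradicting the lower frame bound. Sufficiency
(`exists_isFrameFor`): an explicit vector spans the complement. By `lagrange_identity` its squared
bracket with an element of `W₀` is `S R P` times the fibre norm squared of that element, where `P =
|m(σω)|² S + |m(σω+0.1)|² R` is `Φ(ω)` by the refinement equation; so the factor lies between `a³`
and `b³`. The same bounds on `P`, `S`, `R` turn (i) into (ii) (`filter_bounds`).

Finally, the dilates of `W₀` decompose `L²(G)` orthogonally: the differences of squared norms of
consecutive projections telescope to `‖g‖²` (`hasSum_norm_sq_sub`), so the frame bounds on `W₀`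
carry over to the affine system. -/

@[simp] theorem shift_apply (k : ℤ) (x : G) (j : ℤ) : shift k x j = x (j + k) := rfl

@[simp] theorem sub_apply (x y : G) (j : ℤ) : (x - y) j = x j - y j := by
  rw [sub_eq_add_neg, add_apply, neg_apply, sub_eq_add_neg]

theorem pointOne_apply (j : ℤ) : pointOne j = if j = 1 then 1 else 0 := rfl

theorem add_self (x : G) : x + x = 0 := ext_coord fun j => by
  simpa using CharTwo.add_self_eq_zero (x j)

theorem neg_eq_self (x : G) : -x = x := neg_eq_of_add_eq_zero_left (add_self x)

theorem sub_eq_add (x y : G) : x - y = x + y := by rw [sub_eq_add_neg, neg_eq_self]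

/-- The element of `G` whose only non-zero coordinate is the one at the index `i`. -/
def single (i : ℤ) : G := ⟨fun j => if j = i then 1 else 0, i, fun _ hj => if_neg hj.ne⟩

theorem single_apply (i j : ℤ) : single i j = if j = i then 1 else 0 := rfl

theorem single_mem_Lam {i : ℤ} (hi : i ≤ 0) : single i ∈ Lam := fun j hj => by
  rw [single_apply, if_neg (by omega)]

/-- The cylinder of all points that agree with `x` up to the index `l`. -/
def cylinder (x : G) (l : ℤ) : Set G := {y | ∀ j ≤ l, y j = x j}

theorem measurableSet_cylinder (x : G) (l : ℤ) : MeasurableSet (cylinder x l) :=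
  (isOpen_cylinder x l).measurableSet

theorem cylinder_eq_of_mem {x y : G} {l : ℤ} (h : y ∈ cylinder x l) :
    cylinder y l = cylinder x l := by
  ext z
  exact forall₂_congr fun j hj => by rw [h j hj]

theorem cylinder_subset {x : G} {k l : ℤ} (h : k ≤ l) : cylinder x l ⊆ cylinder x k :=
  fun _ hy j hj => hy j (hj.trans h)

/-- Truncation of `x` after the index `l`. -/
def trunc (l : ℤ) (x : G) : G :=
  ⟨fun j => if j ≤ l then x j else 0, by
    obtain ⟨k, hk⟩ := x.2
    exact ⟨k, fun j hj => by simp [hk j hj]⟩⟩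

theorem trunc_apply (l : ℤ) (x : G) (j : ℤ) : trunc l x j = if j ≤ l then x j else 0 := rfl

theorem trunc_mem_cylinder (l : ℤ) (x : G) : trunc l x ∈ cylinder x l := fun j hj => by
  rw [trunc_apply, if_pos hj]

theorem cylinder_trunc (l : ℤ) (x : G) : cylinder (trunc l x) l = cylinder x l :=
  cylinder_eq_of_mem (trunc_mem_cylinder l x)

theorem finite_support_of_bounded {x : G} {l : ℤ} (h : ∀ j > l, x j = 0) :
    {j | x j ≠ 0}.Finite := by
  obtain ⟨k, hk⟩ := x.2
  refine (Set.finite_Icc k l).subset fun j hj => ⟨?_, ?_⟩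
  · by_contra hlt
    exact hj (hk j (not_le.1 hlt))
  · by_contra hlt
    exact hj (h j (not_le.1 hlt))

/-- A sequence over `ZMod 2` is determined by its support, and the supports here are finite sets of
integers. -/
theorem countable_bounded (l : ℤ) : {x : G | ∀ j > l, x j = 0}.Countable := by
  have h : Set.InjOn (fun x : G => {j | x j ≠ 0}) {x : G | ∀ j > l, x j = 0} := by
    intro x _ y _ hxy
    refine ext_coord fun j => ?_
    have hj : x j ≠ 0 ↔ y j ≠ 0 := Set.ext_iff.1 hxy j
    generalize x j = a at hj ⊢
    generalize y j = b at hj ⊢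
    revert a b
    decide
  refine Set.MapsTo.countable_of_injOn (t := {s : Set ℤ | s.Finite}) ?_ h
    Set.Countable.ofPred_finite
  exact fun x hx => finite_support_of_bounded hx

instance : Countable Lam := (countable_bounded 0).to_subtype

theorem isTopologicalBasis_cylinder : TopologicalSpace.IsTopologicalBasis
    {s : Set G | ∃ (x : G) (l : ℕ), s = cylinder x l} := by
  refine TopologicalSpace.isTopologicalBasis_of_isOpen_of_nhds ?_ ?_
  · rintro _ ⟨x, l, rfl⟩
    exact isOpen_cylinder x l
  · intro x s hx hs
    obtain ⟨l, hl⟩ := isOpen_iff.1 hs x hx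
    exact ⟨cylinder x l.toNat, ⟨x, _, rfl⟩, fun _ _ => rfl,
      fun y hy => hl y fun j hj => hy j (hj.trans (Int.self_le_toNat l))⟩

instance : SecondCountableTopology G := by
  refine isTopologicalBasis_cylinder.secondCountableTopology ?_
  have h : {s : Set G | ∃ (x : G) (l : ℕ), s = cylinder x l} ⊆
      ⋃ l : ℕ, (fun x => cylinder x l) '' {x : G | ∀ j > (l : ℤ), x j = 0} := by
    rintro _ ⟨x, l, rfl⟩
    refine Set.mem_iUnion.2 ⟨l, trunc l x, fun j hj => ?_, cylinder_trunc l x⟩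
    rw [trunc_apply, if_neg (by omega)]
  exact (Set.countable_iUnion fun l : ℕ => (countable_bounded l).image _).mono h

/-- Two cylinders that meet are nested, since both may be recentred at a common point. -/
theorem isPiSystem_cylinder : IsPiSystem {s : Set G | ∃ (x : G) (l : ℕ), s = cylinder x l} := by
  rintro _ ⟨x, k, rfl⟩ _ ⟨y, l, rfl⟩ ⟨z, hx, hy⟩
  rw [← cylinder_eq_of_mem hx, ← cylinder_eq_of_mem hy]
  rcases le_total k l with h | h
  · exact ⟨z, l, Set.inter_eq_self_of_subset_right (cylinder_subset (by exact_mod_cast h))⟩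
  · exact ⟨z, k, Set.inter_eq_self_of_subset_left (cylinder_subset (by exact_mod_cast h))⟩

/-! ### Characters -/

theorem finite_pairing (x ω : G) : (Function.support fun j : ℤ => x j * ω (1 - j)).Finite := by
  obtain ⟨k, hk⟩ := x.2
  obtain ⟨l, hl⟩ := ω.2
  refine (Set.finite_Icc k (1 - l)).subset fun j hj => ⟨?_, ?_⟩
  · by_contra hlt
    exact hj (by simp [hk j (not_le.1 hlt)])
  · by_contra hlt
    exact hj (by simp [hl (1 - j) (by omega)])

theorem neg_one_pow_val_add (a b : ZMod 2) :
    (-1 : ℂ) ^ (a + b).val = (-1) ^ a.val * (-1) ^ b.val := by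
  have h : ∀ a b : ZMod 2, (-1 : ℤ) ^ (a + b).val = (-1) ^ a.val * (-1) ^ b.val := by decide
  exact_mod_cast congrArg (Int.cast (R := ℂ)) (h a b)

theorem χ_add_left (x y ω : G) : χ (x + y) ω = χ x ω * χ y ω := by
  unfold χ
  rw [← neg_one_pow_val_add, ← finsum_add_distrib (finite_pairing x ω) (finite_pairing y ω)]
  simp only [add_apply, add_mul]

theorem χ_comm (x ω : G) : χ x ω = χ ω x := by
  unfold χ
  congr 2
  rw [← finsum_comp_equiv (Equiv.subLeft (1 : ℤ))]
  refine finsum_congr fun j => ?_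
  simp [mul_comm]

theorem χ_add_right (x ω η : G) : χ x (ω + η) = χ x ω * χ x η := by
  rw [χ_comm, χ_add_left, χ_comm ω, χ_comm η]

theorem χ_eq_one {x ω : G} (h : ∀ j, x j * ω (1 - j) = 0) : χ x ω = 1 := by
  simp [χ, h]

@[simp] theorem χ_zero_left (ω : G) : χ 0 ω = 1 := χ_eq_one fun j => by simp

@[simp] theorem norm_χ (x ω : G) : ‖χ x ω‖ = 1 := by simp [χ]

@[simp] theorem conj_χ (x ω : G) : starRingEnd ℂ (χ x ω) = χ x ω := by simp [χ]

theorem χ_single (i : ℤ) (ω : G) : χ (single i) ω = (-1) ^ (ω (1 - i)).val := by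
  unfold χ
  rw [finsum_eq_single _ i fun j hj => by simp [single_apply, hj]]
  simp [single_apply]

theorem χ_shift (k : ℤ) (x ω : G) : χ (shift k x) ω = χ x (shift k ω) := by
  unfold χ
  congr 2
  rw [← finsum_comp_equiv (Equiv.subRight k)]
  refine finsum_congr fun j => ?_
  simp only [shift_apply, Equiv.subRight_apply, sub_add_cancel]
  rw [show 1 - (j - k) = 1 - j + k by ring]

theorem χ_D_D {x ω : G} (hx : x ∈ D) (hω : ω ∈ D) : χ x ω = 1 := χ_eq_one fun j => by
  rcases le_or_gt j 0 with h | h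
  · rw [hx j h, zero_mul]
  · rw [hω (1 - j) (by omega), mul_zero]

theorem χ_Lam_Lam {x ω : G} (hx : x ∈ Lam) (hω : ω ∈ Lam) : χ x ω = 1 := χ_eq_one fun j => by
  rcases le_or_gt j 0 with h | h
  · rw [hω (1 - j) (by omega), mul_zero]
  · rw [hx j h, zero_mul]

/-- `U k` and `U (-k)` annihilate each other: an index `j > k` is paired with `1 - j ≤ -k`. -/
theorem χ_eq_one_of_mem_U {k : ℤ} {x ω : G} (hx : x ∈ U k) (hω : ω ∈ U (-k)) : χ x ω = 1 :=
  χ_eq_one fun j => by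
    rcases le_or_gt j k with h | h
    · rw [hx j h, zero_mul]
    · rw [hω (1 - j) (by omega), mul_zero]

theorem exists_mem_U (x : G) : ∃ k : ℕ, x ∈ U (-(k : ℤ)) := by
  obtain ⟨k, hk⟩ := x.2
  exact ⟨(1 - k).toNat, fun j hj => hk j (by omega)⟩

theorem U_mono {k l : ℤ} (h : k ≤ l) : U l ≤ U k := fun _ hx j hj => hx j (hj.trans h)

/-- The pairing is locally constant: for `x ∈ U (-k)` and `ω ∈ U (-l)`, perturbations of both by
elements of `U (l + k)` contribute only factors one. -/
theorem continuous_χ : Continuous fun p : G × G => χ p.1 p.2 := by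
  refine continuous_iff_continuousAt.2 fun ⟨x, ω⟩ => ?_
  obtain ⟨k, hk⟩ := exists_mem_U x
  obtain ⟨l, hl⟩ := exists_mem_U ω
  refine ContinuousAt.congr (f := fun _ => χ x ω) continuousAt_const ?_
  filter_upwards [prod_mem_nhds ((isOpen_cylinder x (l + k)).mem_nhds fun _ _ => rfl)
    ((isOpen_cylinder ω (l + k)).mem_nhds fun _ _ => rfl)]
  rintro ⟨y, η⟩ ⟨hy, hη⟩
  change ∀ j ≤ _, _ at hy
  change ∀ j ≤ _, _ at hη
  have h1 : y - x ∈ U ((l : ℤ) + k) := fun j hj => by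
    rw [sub_apply, sub_eq_zero]
    exact hy j hj
  have h2 : η - ω ∈ U ((l : ℤ) + k) := fun j hj => by
    rw [sub_apply, sub_eq_zero]
    exact hη j hj
  have e1 : χ (y - x) ω = 1 :=
    χ_eq_one_of_mem_U (U_mono (by omega) h1 : y - x ∈ U (l : ℤ)) hl
  have e2 : χ x (η - ω) = 1 :=
    (χ_comm _ _).trans (χ_eq_one_of_mem_U (U_mono (by omega) h2 : η - ω ∈ U (k : ℤ)) hk)
  have e3 : χ (y - x) (η - ω) = 1 := χ_D_D (U_mono (by omega) h1) (U_mono (by omega) h2)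
  calc χ x ω = χ x ω * χ (y - x) ω * (χ x (η - ω) * χ (y - x) (η - ω)) := by
        rw [e1, e2, e3]; ring
    _ = χ y η := by rw [← χ_add_left, ← χ_add_left, ← χ_add_right]; congr 1 <;> abel

theorem continuous_χ_right (x : G) : Continuous (χ x) :=
  continuous_χ.comp (Continuous.prodMk_right x)

/-! ### Haar measure -/

theorem volume_D : volume (D : Set G) = 1 := Measure.addHaarMeasure_self

theorem measurableSet_U (l : ℤ) : MeasurableSet (U l : Set G) := (isOpen_U l).measurableSet

theorem cylinder_zero (l : ℤ) : cylinder 0 l = (U l : Set G) := rfl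

theorem mem_cylinder_iff_sub {x y : G} {l : ℤ} : y ∈ cylinder x l ↔ y - x ∈ U l :=
  forall₂_congr fun j _ => by rw [sub_apply, sub_eq_zero]

theorem mem_cylinder_iff_add {x y : G} {l : ℤ} : y ∈ cylinder x l ↔ y + x ∈ U l := by
  rw [mem_cylinder_iff_sub, sub_eq_add]

instance : IsFiniteMeasure ((volume : Measure G).restrict (D : Set G)) :=
  ⟨by rw [Measure.restrict_apply_univ, volume_D]; exact ENNReal.one_lt_top⟩

theorem setIntegral_cylinder (f : G → ℂ) (k : G) (l : ℤ) :
    ∫ ω in cylinder k l, f ω = ∫ ω in (U l : Set G), f (ω + k) := by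
  rw [← integral_indicator (measurableSet_cylinder k l), ← integral_indicator (measurableSet_U l),
    ← integral_add_right_eq_self _ k]
  refine integral_congr_ae (.of_forall fun ω => ?_)
  have h : ω + k ∈ cylinder k l ↔ ω ∈ (U l : Set G) := by
    rw [mem_cylinder_iff_sub, add_sub_cancel_right]; rfl
  by_cases hω : ω ∈ (U l : Set G)
  · simp [Set.indicator_of_mem hω, Set.indicator_of_mem (h.2 hω)]
  · simp [Set.indicator_of_notMem hω, Set.indicator_of_notMem (mt h.1 hω)]

theorem volume_cylinder (k : G) (l : ℤ) : volume (cylinder k l) = volume (U l : Set G) := by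
  rw [← measure_preimage_add_right volume k]
  congr 1
  ext ω
  rw [Set.mem_preimage, mem_cylinder_iff_sub, add_sub_cancel_right]
  rfl

theorem volume_U_lt_top (l : ℤ) : volume (U l : Set G) < ∞ := (isCompact_U l).measure_lt_top

/-- If `x j ≠ 0` for some `j ≤ 0`, translation by `single (1 - j)` preserves `D` and changes the
sign of `χ x`, so the integral equals its own negative. -/
theorem integral_χ_D (x : G) [Decidable (x ∈ D)] :
    ∫ ω in (D : Set G), χ x ω = if x ∈ D then 1 else 0 := by
  split_ifs with h
  · rw [setIntegral_congr_fun (g := fun _ => (1 : ℂ)) (measurableSet_U 0)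
      fun ω hω => χ_D_D h hω]
    simp [volume_D, Measure.real]
  · obtain ⟨j, hj, hxj⟩ : ∃ j ≤ 0, x j ≠ 0 := by
      by_contra hcon
      push Not at hcon
      exact h hcon
    have hd : single (1 - j) ∈ D := fun i hi => by rw [single_apply, if_neg (by omega)]
    have hc : χ x (single (1 - j)) = -1 := by
      rw [χ_comm, χ_single, sub_sub_cancel]
      have : ∀ a : ZMod 2, a ≠ 0 → a.val = 1 := by decide
      rw [this _ hxj, pow_one]
    have h1 := setIntegral_cylinder (χ x) (single (1 - j)) 0
    have h2 : cylinder (single (1 - j)) 0 = (D : Set G) :=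
      cylinder_eq_of_mem (x := 0) hd
    rw [h2] at h1
    simp only [χ_add_right, hc, mul_neg_one, integral_neg] at h1
    exact self_eq_neg.1 h1

theorem self_mem_cylinder_trunc (l : ℤ) (x : G) : x ∈ cylinder (trunc l x) l := by
  rw [cylinder_trunc]
  exact fun _ _ => rfl

theorem trunc_mem_Lam (x : G) : trunc 0 x ∈ Lam := fun j hj => by
  rw [trunc_apply, if_neg (by omega)]

theorem eq_zero_of_mem_D_of_mem_Lam {x : G} (h : x ∈ D) (h' : x ∈ Lam) : x = 0 :=
  ext_coord fun j => (le_or_gt j 0).elim (h j) (h' j)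

/-- As `G` has exponent two, adding the integer part `trunc 0 x` to `x` removes it; no other element
of `Λ` does, because `D ∩ Λ = 0`. -/
theorem isAddFundamentalDomain_D : IsAddFundamentalDomain Lam (D : Set G) volume := by
  refine IsAddFundamentalDomain.mk' (measurableSet_U 0).nullMeasurableSet fun x => ?_
  refine ⟨⟨trunc 0 x, trunc_mem_Lam x⟩, ?_, ?_⟩
  · change trunc 0 x + x ∈ U 0
    rw [add_comm]
    exact mem_cylinder_iff_add.1 (self_mem_cylinder_trunc 0 x)
  · rintro ⟨n, hn⟩ h
    change n + x ∈ U 0 at h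
    refine Subtype.ext (sub_eq_zero.1 (eq_zero_of_mem_D_of_mem_Lam ?_ ?_))
    · have h' : x - trunc 0 x ∈ D := mem_cylinder_iff_sub.1
        (by rw [cylinder_trunc]; exact fun j _ => rfl)
      have := D.add_mem h h'
      rwa [show n + x + (x - trunc 0 x) = n - trunc 0 x + (x + x) by abel, add_self,
        add_zero] at this
    · exact Lam.sub_mem hn (trunc_mem_Lam x)

/-- The sum of a function over the cosets of `Λ`. -/
noncomputable def periodize (h : G → ℂ) (ω : G) : ℂ := ∑' n : Lam, h (ω + n)

theorem lintegral_eq_lintegral_D_tsum {f : G → ℝ≥0∞} (hf : AEMeasurable f volume) :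
    ∫⁻ ω, f ω = ∫⁻ ω in (D : Set G), ∑' n : Lam, f (ω + n) := by
  rw [isAddFundamentalDomain_D.lintegral_eq_tsum'', lintegral_tsum]
  · refine tsum_congr fun n => lintegral_congr fun ω => ?_
    rw [add_comm ω]; rfl
  · intro n
    exact (hf.comp_quasiMeasurePreserving
      (measurePreserving_add_right volume (n : G)).quasiMeasurePreserving).restrict

theorem ae_add_Lam {P : G → Prop} (h : ∀ᵐ ω : G, P ω) : ∀ᵐ ω : G, ∀ n : Lam, P (ω + n) :=
  ae_all_iff.2 fun n =>
    (measurePreserving_add_right volume (n : G)).quasiMeasurePreserving.ae h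

theorem ae_of_ae_D {P : G → Prop} (hP : ∀ ω (n : Lam), P (ω + n) → P ω)
    (h : ∀ᵐ ω ∂(volume : Measure G).restrict (D : Set G), P ω) : ∀ᵐ ω : G, P ω := by
  rw [ae_restrict_iff' (measurableSet_U 0)] at h
  filter_upwards [ae_add_Lam h] with ω hω
  refine hP ω ⟨trunc 0 ω, trunc_mem_Lam ω⟩ (hω _ ?_)
  exact mem_cylinder_iff_add.1 (self_mem_cylinder_trunc 0 ω)

theorem periodize_congr {h h' : G → ℂ} (e : h =ᵐ[volume] h') :
    periodize h =ᵐ[volume] periodize h' := by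
  filter_upwards [ae_add_Lam e] with ω hω
  exact tsum_congr hω

theorem tsum_enorm_ne_top {h : G → ℂ} (hh : Integrable h) :
    ∀ᵐ ω ∂(volume : Measure G).restrict (D : Set G), ∑' n : Lam, ‖h (ω + n)‖ₑ ≠ ∞ := by
  have h1 := lintegral_eq_lintegral_D_tsum hh.1.enorm
  refine (ae_lt_top' ?_ (h1 ▸ hh.2.ne)).mono fun _ h => h.ne
  refine AEMeasurable.tsum fun n => ?_
  exact (hh.1.enorm.comp_quasiMeasurePreserving
      (measurePreserving_add_right volume (n : G)).quasiMeasurePreserving).restrict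

theorem integrable_periodize {h : G → ℂ} (hh : Integrable h) :
    Integrable (periodize h) ((volume : Measure G).restrict (D : Set G)) := by
  have h1 := lintegral_eq_lintegral_D_tsum hh.1.enorm
  refine ⟨?_, ?_⟩
  · refine (AEMeasurable.tsum fun n => ?_).aestronglyMeasurable
    exact (hh.1.aemeasurable.comp_quasiMeasurePreserving
      (measurePreserving_add_right volume (n : G)).quasiMeasurePreserving).restrict
  · refine lt_of_le_of_lt (lintegral_mono_ae ?_) (h1.symm.trans_lt hh.2)
    filter_upwards [tsum_enorm_ne_top hh] with ω hω
    exact enorm_tsum_le_tsum_enorm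

theorem integral_eq_integral_periodize {h : G → ℂ} (hh : Integrable h) :
    ∫ ω, h ω = ∫ ω in (D : Set G), periodize h ω := by
  have h1 := lintegral_eq_lintegral_D_tsum hh.1.enorm
  have hm (n : Lam) : AEStronglyMeasurable (fun ω => h (ω + n))
      ((volume : Measure G).restrict (D : Set G)) :=
    (hh.1.comp_quasiMeasurePreserving
      (measurePreserving_add_right volume (n : G)).quasiMeasurePreserving).restrict
  unfold periodize
  rw [integral_tsum hm]
  · rw [isAddFundamentalDomain_D.integral_eq_tsum'' _ hh]
    refine tsum_congr fun n => integral_congr_ae (.of_forall fun ω => ?_)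
    change h (n + ω) = h (ω + n)
    rw [add_comm]
  · rw [← lintegral_tsum fun n => (hm n).enorm, ← h1]
    exact hh.2.ne

theorem periodize_add_Lam (h : G → ℂ) (ω : G) (n : Lam) :
    periodize h (ω + n) = periodize h ω := by
  unfold periodize
  rw [← (Equiv.addLeft n).tsum_eq fun k : Lam => h (ω + k)]
  exact tsum_congr fun k => by simp [add_assoc]

/-! ### Dilations -/

theorem preimage_shift_U (k l : ℤ) : shift k ⁻¹' (U l : Set G) = (U (l + k) : Set G) := by
  ext x
  constructor
  · intro h j hj
    simpa using h (j - k) (by omega)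
  · intro h j hj
    exact h _ (by omega)

/-- `D` is the disjoint union of `U 1` and its translate by `0.1`. This is what fixes the modulus of
`ρ` as `2`. -/
theorem volume_U_one : volume (U 1 : Set G) = 2⁻¹ := by
  have h : (D : Set G) = (U 1 : Set G) ∪ cylinder pointOne 1 := by
    ext x
    constructor
    · intro hx
      have h2 : ∀ a : ZMod 2, a = 0 ∨ a = 1 := by decide
      rcases h2 (x 1) with h1 | h1
      · left
        intro j hj
        rcases hj.lt_or_eq with h | rfl
        · exact hx j (by omega)
        · exact h1
      · right
        intro j hj
        rw [pointOne_apply]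
        split_ifs with h
        · rw [h, h1]
        · exact hx j (by omega)
    · rintro (hx | hx) j hj
      · exact hx j (by omega)
      · rw [hx j (by omega), pointOne_apply, if_neg (by omega)]
  have hd : Disjoint (U 1 : Set G) (cylinder pointOne 1) := by
    refine Set.disjoint_left.2 fun x h1 h2 => ?_
    have := h2 1 le_rfl
    rw [h1 1 le_rfl] at this
    simp [pointOne_apply] at this
  have := volume_D
  rw [h, measure_union hd (measurableSet_cylinder _ _), volume_cylinder, ← two_mul] at this
  exact ENNReal.eq_inv_of_mul_eq_one_left (by rwa [mul_comm])

theorem addHaarChar_shift_one : addEquivAddHaarChar (shift 1) = 2 := by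
  have h := addEquivAddHaarChar_smul_preimage (volume : Measure G) (X := (D : Set G)) (shift 1)
  rw [preimage_shift_U, zero_add, volume_U_one, volume_D, ENNReal.smul_def, smul_eq_mul] at h
  have h2 : (addEquivAddHaarChar (shift 1) : ℝ≥0∞) = 2 := by
    have := ENNReal.eq_inv_of_mul_eq_one_left h
    rwa [inv_inv] at this
  exact_mod_cast h2

theorem map_shift_one : Measure.map (shift 1) (volume : Measure G) = (2⁻¹ : ℝ≥0∞) • volume := by
  have h := addEquivAddHaarChar_smul_map (volume : Measure G) (shift 1)
  rw [addHaarChar_shift_one] at h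
  conv_rhs => rw [← h]
  rw [ENNReal.smul_def, smul_smul]
  simp [ENNReal.inv_mul_cancel]

theorem shift_shift (k l : ℤ) (x : G) : shift k (shift l x) = shift (k + l) x :=
  ext_coord fun j => by simp only [shift_apply]; rw [show j + k + l = j + (k + l) by ring]

@[simp] theorem shift_zero (x : G) : shift 0 x = x := ext_coord fun j => by simp

@[simp] theorem ρ_σ (x : G) : ρ (σ x) = x := by rw [shift_shift]; simp

@[simp] theorem σ_ρ (x : G) : σ (ρ x) = x := by rw [shift_shift]; simp

theorem quasiMeasurePreserving_shift (k : ℤ) :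
    Measure.QuasiMeasurePreserving (shift k) (volume : Measure G) volume := by
  obtain ⟨c, -, hc⟩ := map_shift_le k
  exact ⟨(shift k).continuous_toFun.measurable,
    (Measure.absolutelyContinuous_of_le hc).trans (Measure.smul_absolutelyContinuous)⟩

theorem measurableEmbedding_shift (k : ℤ) : MeasurableEmbedding (shift k) :=
  (shift k).toHomeomorph.measurableEmbedding

theorem integral_comp_ρ (f : G → ℂ) : ∫ x, f (ρ x) = 2⁻¹ * ∫ x, f x := by
  rw [← (measurableEmbedding_shift 1).integral_map, map_shift_one, integral_smul_measure]
  simp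

/-! ### Uniqueness of Fourier coefficients -/

theorem integrable_χ_mul {μ : Measure G} {f : G → ℂ} (hf : Integrable f μ) (n : G) :
    Integrable (fun ω => χ n ω * f ω) μ :=
  hf.bdd_mul (c := 1) (continuous_χ_right n).aestronglyMeasurable (.of_forall fun ω => by simp)

/-- The last factor is the indicator of agreement at the index `l + 1`, detected by the character of
`single (-l)`. Hence refining a cylinder costs only one more character from `Λ`. -/
theorem indicator_cylinder_succ (x : G) (l : ℕ) (ω : G) :
    (cylinder x (l + 1 : ℕ)).indicator (fun _ => (1 : ℂ)) ω =
      (cylinder x l).indicator (fun _ => (1 : ℂ)) ω *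
        ((1 + χ (single (-l)) x * χ (single (-l)) ω) / 2) := by
  by_cases h : ω ∈ cylinder x l
  · have e : ω ∈ cylinder x (l + 1 : ℕ) ↔ ω (1 - -l) = x (1 - -l) := by
      constructor
      · exact fun h' => h' _ (by push_cast; omega)
      · intro h' j hj
        rcases hj.lt_or_eq with h1 | rfl
        · exact h j (by push_cast at h1; omega)
        · rw [show ((l + 1 : ℕ) : ℤ) = 1 - -l by push_cast; ring]
          exact h'
    rw [Set.indicator_of_mem h, χ_single, χ_single, ← neg_one_pow_val_add]
    by_cases h1 : ω (1 - -l) = x (1 - -l)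
    · rw [Set.indicator_of_mem (e.2 h1), h1, CharTwo.add_self_eq_zero]
      norm_num
    · rw [Set.indicator_of_notMem (mt e.1 h1)]
      have h2 : ∀ a b : ZMod 2, a ≠ b → (b + a).val = 1 := by decide
      rw [h2 _ _ h1]
      norm_num
  · rw [Set.indicator_of_notMem h, Set.indicator_of_notMem, zero_mul]
    exact fun h' => h (cylinder_subset (by push_cast; omega) h')

/-- Each refinement expresses an integral through integrals over the coarser cylinder with
frequencies `n` and `n + s`; the induction therefore runs over all frequencies at once. -/
theorem setIntegral_cylinder_eq_zero {f : G → ℂ}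
    (hf : Integrable f ((volume : Measure G).restrict (D : Set G)))
    (h : ∀ n ∈ Lam, ∫ ω in (D : Set G), χ n ω * f ω = 0) (l : ℕ) :
    ∀ n ∈ Lam, ∀ x : G, ∫ ω in cylinder x l, χ n ω * f ω
      ∂((volume : Measure G).restrict (D : Set G)) = 0 := by
  induction l with
  | zero =>
    intro n hn x
    rw [Measure.restrict_restrict (measurableSet_cylinder _ _)]
    by_cases hx : x ∈ D
    · have : cylinder x (0 : ℕ) = (D : Set G) := cylinder_eq_of_mem (x := 0) hx
      rw [this, Set.inter_self]
      exact h n hn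
    · have : cylinder x (0 : ℕ) ∩ (D : Set G) = ∅ := by
        refine Set.eq_empty_of_forall_notMem fun y hy => hx fun j hj => ?_
        rw [← hy.1 j (by simpa using hj), hy.2 j hj]
      rw [this, Measure.restrict_empty, integral_zero_measure]
  | succ l ih =>
    intro n hn x
    set s := single (-(l : ℤ))
    have hs : s ∈ Lam := single_mem_Lam (by omega)
    have e : ∀ ω, (cylinder x (l + 1 : ℕ)).indicator (fun ω => χ n ω * f ω) ω =
        (cylinder x l).indicator (fun ω => 2⁻¹ * (χ n ω * f ω)
          + 2⁻¹ * χ s x * (χ (n + s) ω * f ω)) ω := by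
      intro ω
      have h1 := indicator_cylinder_succ x l ω
      have h2 (t : Set G) (g : G → ℂ) : t.indicator g ω = t.indicator (fun _ => (1 : ℂ)) ω * g ω := by
        by_cases ht : ω ∈ t <;> simp [ht]
      rw [h2, h1, h2 (cylinder x l) (fun ω => 2⁻¹ * (χ n ω * f ω)
        + 2⁻¹ * χ s x * (χ (n + s) ω * f ω)), χ_add_left]
      ring
    rw [← integral_indicator (measurableSet_cylinder _ _)]
    simp_rw [e]
    rw [integral_indicator (measurableSet_cylinder _ _), integral_add, integral_const_mul,
      integral_const_mul, ih n hn, ih _ (Lam.add_mem hn hs)]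
    · simp
    · exact ((integrable_χ_mul hf _).const_mul _).restrict
    · exact ((integrable_χ_mul hf _).const_mul _).restrict

theorem ae_eq_zero_of_forall_coeff {f : G → ℂ}
    (hf : Integrable f ((volume : Measure G).restrict (D : Set G)))
    (h : ∀ n ∈ Lam, ∫ ω in (D : Set G), χ n ω * f ω = 0) :
    f =ᵐ[(volume : Measure G).restrict (D : Set G)] 0 := by
  refine hf.ae_eq_zero_of_forall_setIntegral_eq_zero fun s hs _ => ?_
  have h0 : ∫ ω in (D : Set G), f ω = 0 := by simpa using h 0 Lam.zero_mem
  refine MeasurableSpace.induction_on_inter (C := fun s _ => ∫ ω in s, f ω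
      ∂((volume : Measure G).restrict (D : Set G)) = 0)
    isTopologicalBasis_cylinder.borel_eq_generateFrom isPiSystem_cylinder ?_ ?_ ?_ ?_ s hs
  · simp
  · rintro _ ⟨x, l, rfl⟩
    simpa using setIntegral_cylinder_eq_zero hf h l 0 Lam.zero_mem x
  · intro t ht h1
    rw [setIntegral_compl ht hf, h0, h1, sub_zero]
  · intro t hd ht h1
    rw [integral_iUnion ht hd hf.integrableOn]
    simp [h1]

/-- Each cell `k + D` is translated to `D`, where Walsh coefficients determine an integrable
function; the translation does not affect `χ n`, as `χ n k = 1` on `Λ`. -/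
theorem ae_eq_of_forall_coeff {f g : G → ℂ} (hf : ∀ k ∈ Lam, IntegrableOn f (cylinder k 0))
    (hg : ∀ k ∈ Lam, IntegrableOn g (cylinder k 0))
    (h : ∀ n ∈ Lam, ∀ k ∈ Lam,
      ∫ ω in cylinder k 0, χ n ω * f ω = ∫ ω in cylinder k 0, χ n ω * g ω) :
    f =ᵐ[volume] g := by
  have key : ∀ k : Lam, ∀ᵐ ω, ω ∈ (D : Set G) → f (ω + k) = g (ω + k) := by
    rintro ⟨k, hk⟩
    have tr {u : G → ℂ} (hu : IntegrableOn u (cylinder k 0)) :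
        IntegrableOn (fun ω => u (ω + k)) (D : Set G) := by
      rw [← integrable_indicator_iff (measurableSet_cylinder _ _)] at hu
      rw [← integrable_indicator_iff (measurableSet_U _)]
      refine (hu.comp_add_right k).congr (.of_forall fun ω => ?_)
      have hiff : ω + k ∈ cylinder k 0 ↔ ω ∈ (D : Set G) := by
        rw [mem_cylinder_iff_sub, add_sub_cancel_right]; rfl
      by_cases hω : ω ∈ (D : Set G)
      · simp [Set.indicator_of_mem hω, Set.indicator_of_mem (hiff.2 hω)]
      · simp [Set.indicator_of_notMem hω, Set.indicator_of_notMem (mt hiff.1 hω)]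
    have h1 := ae_eq_zero_of_forall_coeff ((tr (hf k hk)).sub (tr (hg k hk))) fun n hn => by
      have h2 := h n hn k hk
      rw [setIntegral_cylinder, setIntegral_cylinder] at h2
      simp only [χ_add_right, χ_Lam_Lam hn hk, mul_one] at h2
      simp only [Pi.sub_apply, mul_sub]
      rw [integral_sub (integrable_χ_mul (tr (hf k hk)) n) (integrable_χ_mul (tr (hg k hk)) n), h2,
        sub_self]
    filter_upwards [(ae_restrict_iff' (measurableSet_U 0)).1 h1] with ω hω hD
    simpa [sub_eq_zero] using hω hD
  filter_upwards [ae_add_Lam (ae_all_iff.2 key)] with ω hω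
  have h1 := hω ⟨trunc 0 ω, trunc_mem_Lam ω⟩ ⟨trunc 0 ω, trunc_mem_Lam ω⟩
    (mem_cylinder_iff_add.1 (self_mem_cylinder_trunc 0 ω))
  simpa [add_assoc, add_self] using h1

/-! ### An orthonormal basis of `L²(G)` -/

theorem memLp_atom (n k : G) : MemLp ((cylinder k 0).indicator (χ n)) 2 volume := by
  have h : MemLp ((cylinder k 0).indicator fun _ => (1 : ℂ)) 2 volume :=
    memLp_indicator_const 2 (measurableSet_cylinder _ _) 1
      (Or.inr (by rw [volume_cylinder]; exact (volume_U_lt_top 0).ne))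
  refine h.of_le ((continuous_χ_right n).measurable.indicator
    (measurableSet_cylinder _ _)).aestronglyMeasurable (.of_forall fun ω => ?_)
  by_cases hω : ω ∈ cylinder k 0 <;> simp [hω]

/-- The character `χ n` restricted to the cell `k + D`. -/
noncomputable def atom (p : Lam × Lam) : L2 := (memLp_atom p.1 p.2).toLp _

theorem inner_atom (p : Lam × Lam) (f : L2) :
    inner ℂ (atom p) f = ∫ ω in cylinder p.2 0, χ p.1 ω * f ω := by
  rw [L2.inner_def, ← integral_indicator (measurableSet_cylinder _ _)]
  refine integral_congr_ae ?_
  filter_upwards [(memLp_atom p.1 p.2).coeFn_toLp] with ω hω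
  rw [atom, hω]
  by_cases h : ω ∈ cylinder (p.2 : G) 0
  · simp [h, mul_comm]
  · simp [h]

theorem setIntegral_χ (x k : G) [Decidable (x ∈ D)] :
    ∫ ω in cylinder k 0, χ x ω = if x ∈ D then χ x k else 0 := by
  rw [setIntegral_cylinder]
  simp only [χ_add_right]
  rw [integral_mul_const, integral_χ_D]
  split_ifs <;> simp

theorem eq_of_add_mem_D {n k : G} (hn : n ∈ Lam) (hk : k ∈ Lam) (h : n + k ∈ D) : n = k := by
  rw [← sub_eq_add] at h
  exact sub_eq_zero.1 (eq_zero_of_mem_D_of_mem_Lam h (Lam.sub_mem hn hk))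

theorem orthonormal_atom : Orthonormal ℂ atom := by
  classical
  rw [orthonormal_iff_ite]
  rintro ⟨⟨n, hn⟩, ⟨k, hk⟩⟩ ⟨⟨n', hn'⟩, ⟨k', hk'⟩⟩
  rw [inner_atom]
  have e : ∀ᵐ ω, ω ∈ cylinder k 0 → χ n ω * atom (⟨n', hn'⟩, ⟨k', hk'⟩) ω =
      if k = k' then χ (n + n') ω else 0 := by
    filter_upwards [(memLp_atom n' k').coeFn_toLp] with ω hω hωk
    rw [atom, hω]
    split_ifs with h
    · subst h
      rw [Set.indicator_of_mem hωk, χ_add_left]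
    · rw [Set.indicator_of_notMem, mul_zero]
      intro hωk'
      refine h (eq_of_add_mem_D hk hk' ?_)
      have := D.add_mem (mem_cylinder_iff_add.1 hωk) (mem_cylinder_iff_add.1 hωk')
      rwa [add_add_add_comm, add_self, zero_add] at this
  rw [setIntegral_congr_ae (measurableSet_cylinder _ _) e]
  by_cases h : k = k'
  · subst h
    simp only [if_true, setIntegral_χ]
    by_cases h' : n = n'
    · subst h'
      simp [add_self, D.zero_mem]
    · rw [if_neg fun h1 => h' (eq_of_add_mem_D hn hn' h1), if_neg]
      simpa using h'
  · simp [h]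

theorem integrableOn_cylinder {f : G → ℂ} (hf : MemLp f 2 volume) (k : G) (l : ℤ) :
    IntegrableOn f (cylinder k l) := by
  have : IsFiniteMeasure ((volume : Measure G).restrict (cylinder k l)) :=
    ⟨by rw [Measure.restrict_apply_univ, volume_cylinder]; exact volume_U_lt_top l⟩
  exact (hf.restrict _).integrable (by norm_num)

theorem ext_inner_atom {f g : L2} (h : ∀ p, inner ℂ (atom p) f = inner ℂ (atom p) g) : f = g := by
  refine Lp.ext (ae_eq_of_forall_coeff (fun k _ => integrableOn_cylinder (Lp.memLp f) k 0)
    (fun k _ => integrableOn_cylinder (Lp.memLp g) k 0) fun n hn k hk => ?_)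
  simpa [inner_atom] using h (⟨n, hn⟩, ⟨k, hk⟩)

theorem orthogonal_span_atom : (Submodule.span ℂ (Set.range atom))ᗮ = ⊥ := by
  refine (Submodule.eq_bot_iff _).2 fun f hf => ext_inner_atom fun p => ?_
  rw [inner_zero_right]
  exact hf _ (Submodule.subset_span ⟨p, rfl⟩)

/-- The Hilbert basis of `L²(G)` given by the characters restricted to cells. -/
noncomputable def atomBasis : HilbertBasis (Lam × Lam) ℂ L2 :=
  HilbertBasis.mkOfOrthogonalEqBot orthonormal_atom orthogonal_span_atom

@[simp] theorem atomBasis_apply (p : Lam × Lam) : atomBasis p = atom p := by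
  simp [atomBasis]

/-- The Hilbert basis `atomBasis` with time and frequency interchanged. -/
noncomputable def atomBasisSwap : HilbertBasis (Lam × Lam) ℂ L2 :=
  HilbertBasis.mkOfOrthogonalEqBot (v := atom ∘ Prod.swap)
    (orthonormal_atom.comp _ Prod.swap_injective) (by
      rw [Prod.swap_surjective.range_comp]
      exact orthogonal_span_atom)

@[simp] theorem atomBasisSwap_apply (p : Lam × Lam) : atomBasisSwap p = atom p.swap := by
  simp [atomBasisSwap]

/-! ### The Fourier transform as a unitary operator -/

/-- The Fourier transform on `L²(G)`. -/
noncomputable def fourier : L2 ≃ₗᵢ[ℂ] L2 := atomBasis.repr.trans atomBasisSwap.repr.symm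

/-- For `n, k ∈ Λ` the Fourier integral of `χ n` on `k + D` is `χ k` on `n + D`, because `χ n k =
1`. The operator is defined by this exchange of two orthonormal bases, so it is unitary at once; its
agreement with the integral is `fourier_eq_integral`. -/
theorem fourier_atom (p : Lam × Lam) : fourier (atom p) = atom p.swap := by
  classical
  rw [← atomBasis_apply, fourier, LinearIsometryEquiv.trans_apply, HilbertBasis.repr_self,
    HilbertBasis.repr_symm_single, atomBasisSwap_apply]

theorem inner_atom_fourier (p : Lam × Lam) (f : L2) :
    inner ℂ (atom p) (fourier f) = inner ℂ (atom p.swap) f := by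
  rw [← fourier.inner_map_map (atom p.swap), fourier_atom, Prod.swap_swap]

/-! ### Dilations of `L²(G)` -/

theorem coeFn_compShift (k : ℤ) (f : L2) :
    compShift k f =ᵐ[volume] fun x => f (shift k x) := (memLp_comp_shift k f).coeFn_toLp

theorem compShift_add (k : ℤ) (f g : L2) :
    compShift k (f + g) = compShift k f + compShift k g := by
  refine Lp.ext ?_
  filter_upwards [coeFn_compShift k (f + g), coeFn_compShift k f, coeFn_compShift k g,
    Lp.coeFn_add (compShift k f) (compShift k g),
    (quasiMeasurePreserving_shift k).ae (Lp.coeFn_add f g)] with x h1 h2 h3 h4 h5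
  rw [h1, h4, Pi.add_apply, h2, h3, h5, Pi.add_apply]

theorem compShift_smul (k : ℤ) (c : ℂ) (f : L2) : compShift k (c • f) = c • compShift k f := by
  refine Lp.ext ?_
  filter_upwards [coeFn_compShift k (c • f), coeFn_compShift k f,
    Lp.coeFn_smul c (compShift k f),
    (quasiMeasurePreserving_shift k).ae (Lp.coeFn_smul c f)] with x h1 h2 h3 h4
  rw [h1, h3, Pi.smul_apply, h2, h4, Pi.smul_apply]

theorem compShift_compShift (k l : ℤ) (f : L2) :
    compShift k (compShift l f) = compShift (l + k) f := by
  refine Lp.ext ?_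
  filter_upwards [coeFn_compShift k (compShift l f), coeFn_compShift (l + k) f,
    (quasiMeasurePreserving_shift k).ae (coeFn_compShift l f)] with x h1 h2 h3
  rw [h1, h2, h3, shift_shift]

theorem compShift_zero (f : L2) : compShift 0 f = f := by
  refine Lp.ext ?_
  filter_upwards [coeFn_compShift 0 f] with x h1
  rw [h1, shift_zero]

theorem inner_compShift_one (f g : L2) :
    inner ℂ (compShift 1 f) (compShift 1 g) = 2⁻¹ * inner ℂ f g := by
  rw [L2.inner_def, L2.inner_def, ← integral_comp_ρ]
  refine integral_congr_ae ?_
  filter_upwards [coeFn_compShift 1 f, coeFn_compShift 1 g] with x h1 h2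
  rw [h1, h2]

/-- The normalizing factor `2 ^ (j / 2)`. -/
noncomputable def dilFactor (j : ℤ) : ℂ := (((2 : ℝ) ^ ((j : ℝ) / 2) : ℝ) : ℂ)

theorem dilFactor_add (j k : ℤ) : dilFactor (j + k) = dilFactor j * dilFactor k := by
  unfold dilFactor
  rw [← Complex.ofReal_mul, ← Real.rpow_add two_pos]
  push_cast
  rw [add_div]

theorem dilFactor_zero : dilFactor 0 = 1 := by simp [dilFactor]

theorem dilFactor_mul_neg (j : ℤ) : dilFactor j * dilFactor (-j) = 1 := by
  rw [← dilFactor_add, add_neg_cancel, dilFactor_zero]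

theorem conj_dilFactor (j : ℤ) : starRingEnd ℂ (dilFactor j) = dilFactor j := Complex.conj_ofReal _

theorem dilFactor_ne_zero (j : ℤ) : dilFactor j ≠ 0 := fun h => by
  simpa [h] using dilFactor_mul_neg j

theorem dilFactor_one_mul_self : dilFactor 1 * dilFactor 1 = 2 := by
  rw [← dilFactor_add]
  simp [dilFactor]

/-- The unitary operator `f ↦ 2 ^ (1 / 2) f (ρ ·)`. -/
noncomputable def dilOne : L2 ≃ₗᵢ[ℂ] L2 :=
  LinearEquiv.isometryOfInner
    { toFun := fun f => dilFactor 1 • compShift 1 f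
      invFun := fun f => dilFactor (-1) • compShift (-1) f
      map_add' := fun f g => by rw [compShift_add, smul_add]
      map_smul' := fun c f => by rw [compShift_smul, smul_comm]; rfl
      left_inv := fun f => by
        beta_reduce
        rw [compShift_smul, compShift_compShift, smul_smul, mul_comm, dilFactor_mul_neg, one_smul,
          add_neg_cancel, compShift_zero]
      right_inv := fun f => by
        beta_reduce
        rw [compShift_smul, compShift_compShift, smul_smul, dilFactor_mul_neg, one_smul,
          neg_add_cancel, compShift_zero] }
    fun f g => by
      change inner ℂ (dilFactor 1 • compShift 1 f) (dilFactor 1 • compShift 1 g) = _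
      rw [inner_smul_left, inner_smul_right, inner_compShift_one, conj_dilFactor, ← mul_assoc,
        ← mul_assoc, dilFactor_one_mul_self]
      norm_num

theorem dilOne_apply (f : L2) : dilOne f = dilFactor 1 • compShift 1 f := rfl

theorem dilOne_symm_apply (f : L2) : dilOne⁻¹ f = dilFactor (-1) • compShift (-1) f := rfl

/-- The unitary operator `f ↦ 2 ^ (j / 2) f (ρ ^ j ·)`. -/
noncomputable def dil (j : ℤ) : L2 ≃ₗᵢ[ℂ] L2 := dilOne ^ j

theorem dil_add (j k : ℤ) (f : L2) : dil (j + k) f = dil j (dil k f) := by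
  rw [dil, zpow_add]; rfl

theorem dil_zero (f : L2) : dil 0 f = f := rfl

theorem dil_neg_dil (j : ℤ) (f : L2) : dil (-j) (dil j f) = f := by
  rw [← dil_add, neg_add_cancel, dil_zero]

theorem dil_dil_neg (j : ℤ) (f : L2) : dil j (dil (-j) f) = f := by
  rw [← dil_add, add_neg_cancel, dil_zero]

theorem dil_apply (j : ℤ) (f : L2) : dil j f = dilFactor j • compShift j f := by
  induction j generalizing f with
  | zero => rw [dil_zero, dilFactor_zero, one_smul, compShift_zero]
  | succ j ih =>
    rw [dil_add, ih, dil, zpow_one, dilOne_apply, compShift_smul, compShift_compShift, smul_smul,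
      ← dilFactor_add, add_comm (1 : ℤ)]
  | pred j ih =>
    rw [sub_eq_add_neg, dil_add, ih, dil, zpow_neg_one, dilOne_symm_apply, compShift_smul,
      compShift_compShift, smul_smul, ← dilFactor_add, add_comm (-1 : ℤ)]

/-! ### Properties of the Fourier transform -/

theorem integrable_of_support_subset {f : L2} {k : ℤ}
    (hf : ∀ᵐ x, x ∉ (U k : Set G) → f x = 0) : Integrable f := by
  have h := integrableOn_cylinder (Lp.memLp f) 0 k
  rw [cylinder_zero, ← integrable_indicator_iff (measurableSet_U k)] at h
  refine h.congr ?_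
  filter_upwards [hf] with x hx
  by_cases hxk : x ∈ (U k : Set G)
  · simp [Set.indicator_of_mem hxk]
  · simp [Set.indicator_of_notMem hxk, hx hxk]

theorem integrable_prod_mul_χ {f : G → ℂ} (hf : Integrable f) (k : G) :
    Integrable (fun p : G × G => f p.2 * χ p.2 p.1)
      (((volume : Measure G).restrict (cylinder k 0)).prod volume) := by
  have : IsFiniteMeasure ((volume : Measure G).restrict (cylinder k 0)) :=
    ⟨by rw [Measure.restrict_apply_univ, volume_cylinder]; exact volume_U_lt_top 0⟩
  have h1 : Integrable (fun p : G × G => f p.2)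
      (((volume : Measure G).restrict (cylinder k 0)).prod volume) := hf.comp_snd _
  have h2 : Continuous fun p : G × G => χ p.2 p.1 := continuous_χ.comp continuous_swap
  have h3 := h1.bdd_mul (c := 1) h2.aestronglyMeasurable (.of_forall fun p => by simp)
  simpa only [mul_comm] using h3

/-- Both sides have the same coefficients on every cell: after Fubini the inner integral of `χ (x +
n)` over `k + D` vanishes unless `x ∈ n + D`. -/
theorem fourier_eq_integral {f : L2} (hf : Integrable f) :
    fourier f =ᵐ[volume] fun ω => ∫ x, f x * χ x ω := by
  classical
  refine ae_eq_of_forall_coeff (fun k _ => integrableOn_cylinder (Lp.memLp _) k 0)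
    (fun k _ => (integrable_prod_mul_χ hf k).integral_prod_left) fun n hn k hk => ?_
  have h1 := inner_atom_fourier (⟨n, hn⟩, ⟨k, hk⟩) f
  rw [inner_atom, inner_atom] at h1
  refine h1.trans ?_
  have h2 : Integrable (fun p : G × G => χ n p.1 * (f p.2 * χ p.2 p.1))
      (((volume : Measure G).restrict (cylinder k 0)).prod volume) :=
    (integrable_prod_mul_χ hf k).bdd_mul (c := 1) (f := fun p : G × G => χ n p.1)
      ((continuous_χ_right n).comp continuous_fst).aestronglyMeasurable
      (.of_forall fun p => by simp)
  simp_rw [← integral_const_mul]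
  rw [integral_integral_swap h2, ← integral_indicator (measurableSet_cylinder _ _)]
  refine integral_congr_ae (.of_forall fun x => ?_)
  have h3 : ∀ ω, χ n ω * (f x * χ x ω) = f x * χ (x + n) ω := fun ω => by
    rw [χ_add_left]; ring
  simp only [h3]
  rw [integral_const_mul, setIntegral_χ]
  by_cases hx : x ∈ cylinder n 0
  · rw [if_pos (mem_cylinder_iff_add.1 hx)]
    simp only [Prod.swap, Set.indicator_of_mem hx]
    rw [χ_add_left, χ_Lam_Lam hn hk, χ_comm x]
    ring
  · rw [if_neg (mt mem_cylinder_iff_add.2 hx)]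
    simp [Prod.swap, Set.indicator_of_notMem hx]

theorem atom_eq_zero (p : Lam × Lam) : ∀ᵐ x, x ∉ cylinder (p.2 : G) 0 → atom p x = 0 := by
  filter_upwards [(memLp_atom p.1 p.2).coeFn_toLp] with x hx hxk
  rw [atom, hx, Set.indicator_of_notMem hxk]

theorem exists_atom_eq_zero (p : Lam × Lam) :
    ∃ k : ℤ, ∀ᵐ x, x ∉ (U k : Set G) → atom p x = 0 := by
  obtain ⟨k, hk⟩ := exists_mem_U (p.2 : G)
  refine ⟨-k, (atom_eq_zero p).mono fun x hx hxk => hx fun h => hxk fun j hj => ?_⟩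
  rw [h j (by omega), hk j hj]

theorem fourier_compShift_one_atom (p : Lam × Lam) :
    fourier (compShift 1 (atom p)) = (2⁻¹ : ℂ) • compShift (-1) (fourier (atom p)) := by
  obtain ⟨k, hk⟩ := exists_atom_eq_zero p
  have h1 : Integrable (atom p) := integrable_of_support_subset hk
  have h2 : Integrable (compShift 1 (atom p)) := by
    refine integrable_of_support_subset (k := k + 1) ?_
    filter_upwards [coeFn_compShift 1 (atom p), (quasiMeasurePreserving_shift 1).ae hk]
      with x hx hx2 hxk
    rw [hx]
    refine hx2 fun h => hxk ?_
    rw [← preimage_shift_U]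
    exact h
  refine Lp.ext ?_
  filter_upwards [fourier_eq_integral h2, Lp.coeFn_smul (2⁻¹ : ℂ) (compShift (-1) (fourier (atom p))),
    coeFn_compShift (-1) (fourier (atom p)),
    (quasiMeasurePreserving_shift (-1)).ae (fourier_eq_integral h1)] with ω e1 e2 e3 e4
  rw [e1, e2, Pi.smul_apply, e3, e4, smul_eq_mul, ← integral_comp_ρ]
  refine integral_congr_ae ?_
  filter_upwards [coeFn_compShift 1 (atom p)] with x hx
  rw [hx, χ_shift 1, ρ_σ]

theorem fourier_dil_one (f : L2) : fourier (dil 1 f) = dil (-1) (fourier f) := by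
  -- Both sides are bounded operators and the atoms span a dense subspace; atoms are integrable with
  -- support in some `U k`, so there the integral formula and a change of variables apply.
  have h : ((dil 1).trans fourier : L2 →L[ℂ] L2) = (fourier.trans (dil (-1)) : L2 →L[ℂ] L2) := by
    refine ContinuousLinearMap.ext_on (s := Set.range atom) ?_ ?_
    · have := atomBasis.dense_span
      rw [Submodule.dense_iff_topologicalClosure_eq_top, ← this]
      congr 2
      exact congrArg Set.range (funext fun p => (atomBasis_apply p).symm)
    · rintro _ ⟨p, rfl⟩
      change fourier (dil 1 (atom p)) = dil (-1) (fourier (atom p))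
      rw [dil_apply, dil_apply, map_smul, fourier_compShift_one_atom, smul_smul]
      congr 1
      have h1 := dilFactor_one_mul_self
      have h2 := dilFactor_mul_neg 1
      linear_combination (-2⁻¹ : ℂ) * dilFactor 1 * h2 + dilFactor (-1) * 2⁻¹ * h1
  exact congrArg (fun A : L2 →L[ℂ] L2 => A f) h

theorem fourier_compShift_one (f : L2) :
    fourier (compShift 1 f) = (2⁻¹ : ℂ) • compShift (-1) (fourier f) := by
  have h := fourier_dil_one f
  rw [dil_apply, dil_apply, map_smul] at h
  have h1 := dilFactor_one_mul_self
  have h2 := dilFactor_mul_neg 1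
  have h3 := congrArg (fun u => dilFactor (-1) • u) h
  simp only [smul_smul] at h3
  rw [mul_comm, h2, one_smul] at h3
  rw [h3]
  congr 1
  linear_combination (-2⁻¹ * (dilFactor (-1))^2) * h1 + (2⁻¹ * (dilFactor 1 * dilFactor (-1) + 1)) * h2

theorem coeFn_T (n : G) (f : L2) : T n f =ᵐ[volume] fun x => f (x - n) :=
  Lp.coeFn_compMeasurePreserving f (measurePreserving_sub_right volume n)

/-- Among the atoms, translation by `n` moves the cell label and multiplication by `χ n` moves the
frequency label; the Fourier transform interchanges the two labels. -/
theorem fourier_T {n : G} (hn : n ∈ Lam) (f : L2) :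
    fourier (T n f) =ᵐ[volume] fun ω => χ n ω * fourier f ω := by
  refine ae_eq_of_forall_coeff (fun k _ => integrableOn_cylinder (Lp.memLp _) k 0)
    (fun k _ => integrable_χ_mul (integrableOn_cylinder (Lp.memLp _) k 0) n) fun p hp k hk => ?_
  have h1 := inner_atom_fourier (⟨p, hp⟩, ⟨k, hk⟩) (T n f)
  have h2 := inner_atom_fourier (⟨p + n, Lam.add_mem hp hn⟩, ⟨k, hk⟩) f
  simp only [Prod.swap, inner_atom] at h1 h2
  simp only [← mul_assoc, ← χ_add_left]
  rw [h1, h2, setIntegral_cylinder _ p, setIntegral_cylinder _ (p + n)]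
  refine integral_congr_ae (ae_restrict_of_ae ?_)
  filter_upwards [(measurePreserving_add_right volume p).quasiMeasurePreserving.ae (coeFn_T n f)]
    with ω hω
  rw [hω, sub_eq_add, χ_add_right, χ_add_right, χ_add_right, χ_Lam_Lam hk hp, χ_Lam_Lam hk hn,
    add_assoc]
  ring

/-- The truncations of `f` to `U (-k)` are integrable, so their transforms are the approximating
integrals, which converge to `g`. Paired with a fixed atom they are eventually constant, once `U
(-k)` contains the relevant cell. -/
theorem fourier_eq_of_isFourierTransform {f : L2} {g : G → ℂ} (h : IsFourierTransform f g) :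
    fourier f =ᵐ[volume] g := by
  obtain ⟨hg, hlim⟩ := h
  have hm (k : ℕ) : MemLp ((U (-(k : ℤ)) : Set G).indicator f) 2 volume :=
    (Lp.memLp f).indicator (measurableSet_U _)
  have hsupp (k : ℕ) : ∀ᵐ x, x ∉ (U (-(k : ℤ)) : Set G) → (hm k).toLp _ x = 0 := by
    filter_upwards [(hm k).coeFn_toLp] with x hx hxk
    rw [hx, Set.indicator_of_notMem hxk]
  have hF (k : ℕ) : fourier ((hm k).toLp _) =ᵐ[volume]
      fun ω => ∫ x in (U (-(k : ℤ)) : Set G), f x * starRingEnd ℂ (χ x ω) := by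
    filter_upwards [fourier_eq_integral (integrable_of_support_subset (hsupp k))] with ω hω
    rw [hω, ← integral_indicator (measurableSet_U _)]
    refine integral_congr_ae ?_
    filter_upwards [(hm k).coeFn_toLp] with x hx
    rw [hx]
    by_cases hxk : x ∈ (U (-(k : ℤ)) : Set G)
    · simp [Set.indicator_of_mem hxk]
    · simp [Set.indicator_of_notMem hxk]
  have hconv : Tendsto (fun k => fourier ((hm k).toLp _)) atTop (𝓝 (hg.toLp g)) := by
    rw [Lp.tendsto_Lp_iff_tendsto_eLpNorm']
    refine hlim.congr fun k => eLpNorm_congr_ae ?_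
    filter_upwards [hF k, hg.coeFn_toLp] with ω h1 h2
    rw [Pi.sub_apply, h1, h2]
  suffices hfg : fourier f = hg.toLp g by
    rw [hfg]
    exact hg.coeFn_toLp
  refine ext_inner_atom fun p => ?_
  refine tendsto_nhds_unique (tendsto_const_nhds.congr' ?_)
    ((tendsto_const_nhds (x := atom p)).inner hconv)
  obtain ⟨K, hK⟩ := exists_mem_U (p.1 : G)
  filter_upwards [eventually_ge_atTop K] with k hk
  rw [inner_atom_fourier, inner_atom_fourier, inner_atom, inner_atom]
  refine setIntegral_congr_ae (measurableSet_cylinder _ _) ?_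
  filter_upwards [(hm k).coeFn_toLp] with x hx hxp
  rw [hx, Set.indicator_of_mem]
  intro j hj
  rw [hxp j (by omega)]
  exact hK j (by omega)

/-! ### Brackets -/

/-- The bracket `[f, g](ω) = ∑ n ∈ Λ, conj (f (ω + n)) g (ω + n)`. -/
noncomputable def bracket (f g : G → ℂ) : G → ℂ :=
  periodize fun ω => starRingEnd ℂ (f ω) * g ω

/-- The periodization `∑ n ∈ Λ, |f (ω + n)|²`. -/
noncomputable def sqSum (f : G → ℂ) (ω : G) : ℝ := ∑' n : Lam, ‖f (ω + n)‖ ^ 2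

/-- Square summability of `f` on the coset `ω + Λ`. -/
def SqSummable (f : G → ℂ) (ω : G) : Prop := Summable fun n : Lam => ‖f (ω + n)‖ ^ 2

/-- `f` is invariant under translation by `Λ`. -/
def IsPeriodic {α : Type*} (f : G → α) : Prop := ∀ ω, ∀ n ∈ Lam, f (ω + n) = f ω

theorem bracket_self (f : G → ℂ) (ω : G) : bracket f f ω = (sqSum f ω : ℂ) := by
  rw [sqSum, Complex.ofReal_tsum]
  exact tsum_congr fun n => by simp [Complex.conj_mul']

theorem sqSum_nonneg (f : G → ℂ) (ω : G) : 0 ≤ sqSum f ω := tsum_nonneg fun _ => by positivity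

theorem isPeriodic_bracket (f g : G → ℂ) : IsPeriodic (bracket f g) :=
  fun ω n hn => periodize_add_Lam _ ω ⟨n, hn⟩

theorem isPeriodic_sqSum (f : G → ℂ) : IsPeriodic (sqSum f) := fun ω n hn => by
  have h := isPeriodic_bracket f f ω n hn
  rw [bracket_self, bracket_self] at h
  exact_mod_cast h

theorem measurable_add_right (n : G) : Measurable fun ω : G => ω + n :=
  (continuous_add_const n).measurable

theorem measurable_bracket {f g : G → ℂ} (hf : Measurable f) (hg : Measurable g) :
    Measurable (bracket f g) :=
  Measurable.tsum fun n => ((Complex.continuous_conj.measurable.comp hf).mul hg).comp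
    (measurable_add_right n)

theorem measurable_sqSum {f : G → ℂ} (hf : Measurable f) : Measurable (sqSum f) :=
  Measurable.tsum fun n => ((hf.comp (measurable_add_right n)).norm.pow_const 2)

theorem bracket_mul_left {r : G → ℂ} (hr : IsPeriodic r) (f g : G → ℂ) (ω : G) :
    bracket (fun ω => r ω * f ω) g ω = starRingEnd ℂ (r ω) * bracket f g ω := by
  unfold bracket periodize
  rw [← tsum_mul_left]
  refine tsum_congr fun n => ?_
  beta_reduce
  rw [hr ω n n.2, map_mul, mul_assoc]

theorem bracket_mul_right {r : G → ℂ} (hr : IsPeriodic r) (f g : G → ℂ) (ω : G) :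
    bracket f (fun ω => r ω * g ω) ω = r ω * bracket f g ω := by
  unfold bracket periodize
  rw [← tsum_mul_left]
  refine tsum_congr fun n => ?_
  beta_reduce
  rw [hr ω n n.2]
  ring

theorem bracket_congr {f g f' g' : G → ℂ} (hf : f =ᵐ[volume] f') (hg : g =ᵐ[volume] g') :
    bracket f g =ᵐ[volume] bracket f' g' := by
  refine periodize_congr ?_
  filter_upwards [hf, hg] with ω h1 h2
  rw [h1, h2]

theorem sqSum_congr {f f' : G → ℂ} (hf : f =ᵐ[volume] f') : sqSum f =ᵐ[volume] sqSum f' := by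
  filter_upwards [bracket_congr hf hf] with ω h
  rw [bracket_self, bracket_self] at h
  exact_mod_cast h

theorem norm_bracket_sq_le {f g : G → ℂ} {ω : G} (hf : SqSummable f ω) (hg : SqSummable g ω) :
    ‖bracket f g ω‖ ^ 2 ≤ sqSum f ω * sqSum g ω := by
  have hf' : Summable fun n : Lam => ‖f (ω + n)‖ ^ (2 : ℝ) := by simpa using! hf
  have hg' : Summable fun n : Lam => ‖g (ω + n)‖ ^ (2 : ℝ) := by simpa using! hg
  have hs := Real.summable_mul_of_Lp_Lq_of_nonneg Real.HolderConjugate.two_two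
    (fun n : Lam => norm_nonneg (f (ω + n))) (fun n => norm_nonneg (g (ω + n))) hf' hg'
  have h := Real.inner_le_Lp_mul_Lq_tsum_of_nonneg Real.HolderConjugate.two_two
    (fun n : Lam => norm_nonneg (f (ω + n))) (fun n => norm_nonneg (g (ω + n))) hf' hg'
  simp only [Real.rpow_two, ← Real.sqrt_eq_rpow] at h
  have h1 : ‖bracket f g ω‖ ≤ ∑' n : Lam, ‖f (ω + n)‖ * ‖g (ω + n)‖ :=
    tsum_of_norm_bounded hs.hasSum fun n => by simp
  calc ‖bracket f g ω‖ ^ 2 ≤ (√(sqSum f ω) * √(sqSum g ω)) ^ 2 := by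
        gcongr
        exact h1.trans h
    _ = _ := by rw [mul_pow, Real.sq_sqrt (sqSum_nonneg f ω), Real.sq_sqrt (sqSum_nonneg g ω)]

theorem integrable_conj_mul {f g : G → ℂ} (hf : MemLp f 2 (volume : Measure G))
    (hg : MemLp g 2 (volume : Measure G)) :
    Integrable (fun ω => starRingEnd ℂ (f ω) * g ω) := by
  have h : MemLp (fun ω => starRingEnd ℂ (f ω)) 2 (volume : Measure G) := hf.star
  exact h.integrable_mul hg

theorem ae_sqSummable {f : G → ℂ} (hf : MemLp f 2 (volume : Measure G)) :
    ∀ᵐ ω : G, SqSummable f ω := by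
  refine ae_of_ae_D (fun ω n h => ?_) ?_
  · unfold SqSummable at h ⊢
    rw [← (Equiv.addLeft n).summable_iff]
    refine h.congr fun k => ?_
    simp [add_assoc]
  · filter_upwards [tsum_enorm_ne_top (integrable_conj_mul hf hf)] with ω hω
    rw [tsum_enorm_ne_top_iff_summable_norm] at hω
    refine hω.congr fun n => ?_
    rw [norm_mul, RCLike.norm_conj, sq]

theorem inner_eq_integral_bracket (f g : L2) :
    inner ℂ f g = ∫ ω in (D : Set G), bracket (fourier f) (fourier g) ω := by
  rw [← fourier.inner_map_map, L2.inner_def]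
  unfold bracket
  rw [← integral_eq_integral_periodize
    (integrable_conj_mul (Lp.memLp (fourier f)) (Lp.memLp (fourier g)))]
  refine integral_congr_ae (.of_forall fun ω => ?_)
  simp [mul_comm]

theorem integrable_bracket {f g : G → ℂ} (hf : MemLp f 2 (volume : Measure G))
    (hg : MemLp g 2 (volume : Measure G)) :
    Integrable (bracket f g) ((volume : Measure G).restrict (D : Set G)) :=
  integrable_periodize (integrable_conj_mul hf hg)

theorem integrable_sqSum {f : G → ℂ} (hf : MemLp f 2 (volume : Measure G)) :
    Integrable (sqSum f) ((volume : Measure G).restrict (D : Set G)) := by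
  have h := (integrable_bracket hf hf).re
  simpa [bracket_self] using h

theorem norm_sq_eq_integral_sqSum (f : L2) :
    ‖f‖ ^ 2 = ∫ ω in (D : Set G), sqSum (fourier f) ω := by
  rw [← inner_self_eq_norm_sq (𝕜 := ℂ), inner_eq_integral_bracket]
  simp only [bracket_self]
  rw [integral_complex_ofReal]
  exact Complex.ofReal_re _

theorem isPeriodic_χ {n : G} (hn : n ∈ Lam) : IsPeriodic (χ n) := fun ω k hk => by
  rw [χ_add_right, χ_Lam_Lam hn hk, mul_one]

/-- The character is `Λ`-periodic and so leaves the bracket: these scalar products are Walsh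
coefficients of one function on `D`. -/
theorem inner_T {n : G} (hn : n ∈ Lam) (f g : L2) :
    inner ℂ (T n f) g =
      ∫ ω in (D : Set G), χ n ω * bracket (fourier f) (fourier g) ω := by
  rw [inner_eq_integral_bracket]
  refine integral_congr_ae (ae_restrict_of_ae ?_)
  filter_upwards [bracket_congr (fourier_T hn f) (EventuallyEq.refl _ (fourier g))] with ω h
  rw [h, bracket_mul_left (isPeriodic_χ hn), conj_χ]

/-- Parseval on `D`: extend `k` by zero to `G`; among all atoms only those over the cell `D` have
non-zero coefficients. -/
theorem hasSum_norm_coeff_sq {k : G → ℂ}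
    (hk : MemLp k 2 ((volume : Measure G).restrict (D : Set G))) :
    HasSum (fun n : Lam => ‖∫ ω in (D : Set G), χ n ω * k ω‖ ^ 2)
      (∫ ω in (D : Set G), ‖k ω‖ ^ 2) := by
  have hk' : MemLp ((D : Set G).indicator k) 2 volume :=
    (memLp_indicator_iff_restrict (measurableSet_U 0)).2 hk
  set f : L2 := hk'.toLp _
  have hf : f =ᵐ[volume] (D : Set G).indicator k := hk'.coeFn_toLp
  have h0 (n : Lam) : inner ℂ (atom (n, 0)) f = ∫ ω in (D : Set G), χ n ω * k ω := by
    rw [inner_atom]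
    refine setIntegral_congr_ae (measurableSet_cylinder _ _) ?_
    filter_upwards [hf] with ω hω hD
    rw [hω, Set.indicator_of_mem (show ω ∈ (D : Set G) from hD)]
  have h1 (p : Lam × Lam) (hp : p.2 ≠ 0) : inner ℂ (atom p) f = 0 := by
    rw [inner_atom, setIntegral_congr_ae (g := fun _ => (0 : ℂ)) (measurableSet_cylinder _ _)]
    · simp
    · filter_upwards [hf] with ω hω hωp
      rw [hω, Set.indicator_of_notMem, mul_zero]
      intro hD
      refine hp (Subtype.ext (eq_of_add_mem_D p.2.2 Lam.zero_mem ?_))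
      change (p.2 : G) + 0 ∈ D
      rw [add_zero]
      have := D.add_mem hD (mem_cylinder_iff_add.1 hωp)
      rwa [← add_assoc, add_self, zero_add] at this
  have h2 : HasSum (fun p => ‖inner ℂ (atom p) f‖ ^ 2) (‖f‖ ^ 2) := by
    have h := Complex.hasSum_re (atomBasis.hasSum_inner_mul_inner f f)
    rw [inner_self_eq_norm_sq_to_K] at h
    convert h using 1
    · ext p
      rw [atomBasis_apply, ← inner_conj_symm f, Complex.conj_mul']
      norm_cast
    · norm_cast
  have h3 : ‖f‖ ^ 2 = ∫ ω in (D : Set G), ‖k ω‖ ^ 2 := by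
    rw [← inner_self_eq_norm_sq (𝕜 := ℂ), L2.inner_def]
    have e : ∀ᵐ ω, inner ℂ (f ω) (f ω) =
        (((D : Set G).indicator (fun ω => ‖k ω‖ ^ 2) ω : ℝ) : ℂ) := by
      filter_upwards [hf] with ω hω
      rw [hω]
      by_cases hD : ω ∈ (D : Set G)
      · simp [Set.indicator_of_mem hD]
      · simp [Set.indicator_of_notMem hD]
    rw [integral_congr_ae e, integral_complex_ofReal,
      integral_indicator (measurableSet_U 0)]
    exact Complex.ofReal_re _
  rw [h3] at h2
  have hinj : Function.Injective fun n : Lam => (n, (0 : Lam)) := fun a b h => by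
    simpa using h
  rw [← hinj.hasSum_iff] at h2
  · exact h2.congr_fun fun n => by simp [h0]
  · rintro ⟨n, m⟩ hp
    rw [h1]
    · simp
    · rintro rfl
      exact hp ⟨n, rfl⟩

theorem hasSum_inner_T {f g : L2}
    (h : MemLp (bracket (fourier f) (fourier g)) 2 ((volume : Measure G).restrict (D : Set G))) :
    HasSum (fun n : Lam => ‖inner ℂ (T n f) g‖ ^ 2)
      (∫ ω in (D : Set G), ‖bracket (fourier f) (fourier g) ω‖ ^ 2) := by
  simpa only [inner_T (Subtype.prop _)] using hasSum_norm_coeff_sq h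

theorem bracket_eq_zero_of_forall_inner_T {f g : L2} (h : ∀ n ∈ Lam, inner ℂ (T n f) g = 0) :
    bracket (fourier f) (fourier g) =ᵐ[(volume : Measure G).restrict (D : Set G)] 0 :=
  ae_eq_zero_of_forall_coeff (integrable_bracket (Lp.memLp _) (Lp.memLp _)) fun n hn => by
    rw [← inner_T hn]
    exact h n hn

theorem inner_T_eq_zero_of_bracket {f g : L2}
    (h : bracket (fourier f) (fourier g) =ᵐ[(volume : Measure G).restrict (D : Set G)] 0)
    {n : G} (hn : n ∈ Lam) : inner ℂ (T n f) g = 0 := by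
  rw [inner_T hn, integral_eq_zero_of_ae]
  filter_upwards [h] with ω hω
  rw [hω, Pi.zero_apply, mul_zero]

/-! ### Shift-invariant spaces -/

theorem IsFrameFor.eq_zero {ι : Type} {f : ι → L2} {W : Submodule ℂ L2} (hf : IsFrameFor f W)
    {g : L2} (hg : g ∈ W) (h : ∀ i, inner ℂ (f i) g = 0) : g = 0 := by
  obtain ⟨-, a, b, ha, -, hab⟩ := hf
  have h1 := (hab g hg).2.1
  simp only [h, norm_zero, ne_eq, OfNat.ofNat_ne_zero, not_false_eq_true, zero_pow, tsum_zero] at h1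
  have h2 : ‖g‖ ^ 2 ≤ 0 := by
    by_contra hlt
    exact absurd h1 (not_le.2 (mul_pos ha (not_le.1 hlt)))
  simpa using le_antisymm h2 (sq_nonneg _)

/-- If `h ⊥ W`, its bracket with `φ` vanishes, and the periodic factor `r` leaves the bracket; so `f
⊥ h`, and `W` is its own double complement. No bound on `r` is needed because `f` is already in
`L²`. -/
theorem mem_of_fourier_eq_mul {W : Submodule ℂ L2} (hW : IsClosed (W : Set L2)) {φ : L2}
    (hφ : ∀ n ∈ Lam, T n φ ∈ W) {f : L2} {r : G → ℂ} (hr : IsPeriodic r)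
    (hf : fourier f =ᵐ[volume] fun ω => r ω * fourier φ ω) : f ∈ W := by
  have : CompleteSpace W := hW.completeSpace_coe
  rw [← Submodule.orthogonal_orthogonal W]
  intro h hh
  have h1 := bracket_eq_zero_of_forall_inner_T (f := φ) (g := h) fun n hn => hh _ (hφ n hn)
  rw [← inner_conj_symm, inner_eq_integral_bracket, integral_eq_zero_of_ae, map_zero]
  filter_upwards [h1, ae_restrict_of_ae (bracket_congr hf (EventuallyEq.refl _ (fourier h)))]
    with ω e1 e2
  rw [e2, bracket_mul_left hr, e1, Pi.zero_apply, mul_zero]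

theorem memLp_of_integrable_sqSum {f : G → ℂ} (hf : AEMeasurable f (volume : Measure G))
    (hs : ∀ᵐ ω : G, SqSummable f ω)
    (h : Integrable (sqSum f) ((volume : Measure G).restrict (D : Set G))) :
    MemLp f 2 (volume : Measure G) := by
  refine ⟨hf.aestronglyMeasurable, ?_⟩
  rw [eLpNorm_lt_top_iff_lintegral_rpow_enorm_lt_top two_ne_zero ENNReal.ofNat_ne_top]
  have h0 : AEMeasurable (fun ω => ‖f ω‖ₑ ^ (2 : ℝ≥0∞).toReal) (volume : Measure G) :=
    hf.enorm.pow_const _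
  rw [lintegral_eq_lintegral_D_tsum h0]
  refine lt_of_eq_of_lt (lintegral_congr_ae ?_) h.2
  filter_upwards [ae_restrict_of_ae hs] with ω hω
  rw [sqSum, Real.enorm_of_nonneg (tsum_nonneg fun _ => by positivity),
    ENNReal.ofReal_tsum_of_nonneg (fun _ => by positivity) hω]
  refine tsum_congr fun n => ?_
  rw [ENNReal.ofReal_pow (norm_nonneg _), ofReal_norm]
  simp

theorem sqSum_mul {r : G → ℂ} (hr : IsPeriodic r) (f : G → ℂ) (ω : G) :
    sqSum (fun ω => r ω * f ω) ω = ‖r ω‖ ^ 2 * sqSum f ω := by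
  unfold sqSum
  rw [← tsum_mul_left]
  refine tsum_congr fun n => ?_
  beta_reduce
  rw [hr ω n n.2, norm_mul, mul_pow]

theorem SqSummable.mul {r f : G → ℂ} {ω : G} (h : SqSummable f ω) (hr : IsPeriodic r) :
    SqSummable (fun ω => r ω * f ω) ω := by
  refine (Summable.mul_left (‖r ω‖ ^ 2) h).congr fun n => ?_
  beta_reduce
  rw [hr ω n n.2, norm_mul, mul_pow]

theorem memLp_mul_of_le {r f : G → ℂ} (hrm : Measurable r) (hr : IsPeriodic r)
    (hf : MemLp f 2 (volume : Measure G)) {u : G → ℝ}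
    (hu : Integrable u ((volume : Measure G).restrict (D : Set G)))
    (h : ∀ᵐ ω ∂(volume : Measure G).restrict (D : Set G), ‖r ω‖ ^ 2 * sqSum f ω ≤ u ω) :
    MemLp (fun ω => r ω * f ω) 2 (volume : Measure G) := by
  refine memLp_of_integrable_sqSum (hrm.aemeasurable.mul hf.1.aemeasurable)
    ((ae_sqSummable hf).mono fun ω hω => hω.mul hr) ?_
  simp only [funext (sqSum_mul hr f)]
  refine hu.mono' (((hrm.norm.pow_const 2).aestronglyMeasurable).mul (integrable_sqSum hf).1) ?_
  filter_upwards [h] with ω hω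
  rwa [Real.norm_of_nonneg (mul_nonneg (by positivity) (sqSum_nonneg _ _))]

theorem exists_fourier_eq {f : G → ℂ} (hf : MemLp f 2 (volume : Measure G)) :
    ∃ g : L2, fourier g =ᵐ[volume] f :=
  ⟨fourier.symm (hf.toLp f), by rw [LinearIsometryEquiv.apply_symm_apply]; exact hf.coeFn_toLp⟩

theorem measurable_coe (f : L2) : Measurable f := (Lp.stronglyMeasurable f).measurable

theorem exists_fourier_eq_mul_of_mem {W : Submodule ℂ L2} (hW : IsClosed (W : Set L2)) {φ : L2}
    (hφ : IsFrameFor (fun n : Lam => T n φ) W) {f : L2} (hf : f ∈ W) :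
    ∃ r : G → ℂ, Measurable r ∧ IsPeriodic r ∧
      fourier f =ᵐ[volume] fun ω => r ω * fourier φ ω := by
  -- The coefficient of the fibrewise projection onto `φ̂`. Where the denominator vanishes the
  -- quotient is `0` by convention, and the numerator vanishes there too, by Cauchy–Schwarz.
  set r : G → ℂ := fun ω => bracket (fourier φ) (fourier f) ω / (sqSum (fourier φ) ω : ℂ)
  have hrm : Measurable r := (measurable_bracket (measurable_coe _) (measurable_coe _)).div
    (Complex.measurable_ofReal.comp (measurable_sqSum (measurable_coe _)))
  have hr : IsPeriodic r := fun ω n hn => by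
    simp only [r]
    rw [isPeriodic_bracket _ _ ω n hn, isPeriodic_sqSum _ ω n hn]
  have hCS : ∀ᵐ ω : G, ‖bracket (fourier φ) (fourier f) ω‖ ^ 2 ≤
      sqSum (fourier φ) ω * sqSum (fourier f) ω := by
    filter_upwards [ae_sqSummable (Lp.memLp (fourier φ)), ae_sqSummable (Lp.memLp (fourier f))]
      with ω h1 h2 using norm_bracket_sq_le h1 h2
  have hmem : MemLp (fun ω => r ω * fourier φ ω) 2 (volume : Measure G) := by
    refine memLp_mul_of_le hrm hr (Lp.memLp _) (integrable_sqSum (Lp.memLp (fourier f)))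
      (ae_restrict_of_ae ?_)
    filter_upwards [hCS] with ω hω
    rcases (sqSum_nonneg (fourier φ) ω).eq_or_lt with h0 | h0
    · rw [← h0, mul_zero]
      exact sqSum_nonneg _ _
    · simp only [r]
      rw [norm_div, Complex.norm_real, Real.norm_of_nonneg h0.le, div_pow, sq (sqSum (fourier φ) ω),
        div_mul_eq_mul_div, div_le_iff₀ (by positivity)]
      nlinarith
  obtain ⟨g, hg⟩ := exists_fourier_eq hmem
  have hgW : g ∈ W := mem_of_fourier_eq_mul hW (fun n hn => hφ.1 ⟨n, hn⟩) hr hg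
  -- `f - g` lies in `W` and is orthogonal to every translate of `φ`, so the lower frame bound
  -- annihilates it.
  have hfg : f - g = 0 := by
    refine hφ.eq_zero (W.sub_mem hf hgW) fun n => ?_
    rw [inner_sub_right, inner_T n.2, inner_T n.2, sub_eq_zero]
    refine integral_congr_ae (ae_restrict_of_ae ?_)
    filter_upwards [bracket_congr (EventuallyEq.refl _ (fourier φ)) hg, hCS] with ω h1 h2
    rw [h1, bracket_mul_right hr, bracket_self]
    by_cases h0 : sqSum (fourier φ) ω = 0
    · rw [h0, zero_mul] at h2
      have h3 : bracket (fourier φ) (fourier f) ω = 0 := by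
        simpa using le_antisymm h2 (sq_nonneg _)
      simp [r, h3]
    · have h0' : (sqSum (fourier φ) ω : ℂ) ≠ 0 := by exact_mod_cast h0
      simp only [r]
      rw [div_mul_cancel₀ _ h0']
  rw [← sub_eq_zero.1 hfg] at hg
  exact ⟨r, hrm, hr, hg⟩

/-- The frame inequalities are tested on the `g` whose transform is `φ̂` cut off to `{Φ ∈ s}`: then
`‖g‖²` is the integral of `Φ` and the coefficient sum that of `Φ²`. The bound `K` on `s` makes the
bracket square integrable. -/
theorem frame_bounds_indicator {W : Submodule ℂ L2} (hW : IsClosed (W : Set L2)) {φ : L2}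
    (hφ : ∀ n ∈ Lam, T n φ ∈ W) {a b : ℝ}
    (hab : ∀ g ∈ W, Summable (fun n : Lam => ‖inner ℂ (T n φ) g‖ ^ 2) ∧
      a * ‖g‖ ^ 2 ≤ ∑' n : Lam, ‖inner ℂ (T n φ) g‖ ^ 2 ∧
      ∑' n : Lam, ‖inner ℂ (T n φ) g‖ ^ 2 ≤ b * ‖g‖ ^ 2)
    {s : Set ℝ} (hs : MeasurableSet s) {K : ℝ} (hK : ∀ x ∈ s, x ≤ K) :
    IntegrableOn (fun ω => sqSum (fourier φ) ω ^ 2)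
        ((D : Set G) ∩ sqSum (fourier φ) ⁻¹' s) ∧
      a * ∫ ω in (D : Set G) ∩ sqSum (fourier φ) ⁻¹' s, sqSum (fourier φ) ω ≤
        ∫ ω in (D : Set G) ∩ sqSum (fourier φ) ⁻¹' s, sqSum (fourier φ) ω ^ 2 ∧
      ∫ ω in (D : Set G) ∩ sqSum (fourier φ) ⁻¹' s, sqSum (fourier φ) ω ^ 2 ≤
        b * ∫ ω in (D : Set G) ∩ sqSum (fourier φ) ⁻¹' s, sqSum (fourier φ) ω := by
  set Φ := sqSum (fourier φ)
  have hΦm : Measurable Φ := measurable_sqSum (measurable_coe _)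
  have hE : MeasurableSet (Φ ⁻¹' s) := hΦm hs
  set r : G → ℂ := (Φ ⁻¹' s).indicator 1
  have hrm : Measurable r := measurable_one.indicator hE
  have hr : IsPeriodic r := fun ω n hn => by
    have h : ω + n ∈ Φ ⁻¹' s ↔ ω ∈ Φ ⁻¹' s := by
      rw [Set.mem_preimage, Set.mem_preimage, show Φ (ω + n) = Φ ω from isPeriodic_sqSum _ ω n hn]
    by_cases h' : ω ∈ Φ ⁻¹' s
    · simp only [r, Set.indicator_of_mem h', Set.indicator_of_mem (h.2 h'), Pi.one_apply]
    · simp only [r, Set.indicator_of_notMem h', Set.indicator_of_notMem (mt h.1 h')]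
  have hr2 (ω : G) : ‖r ω‖ ^ 2 = (Φ ⁻¹' s).indicator 1 ω := by
    by_cases h : ω ∈ Φ ⁻¹' s <;> simp [r, h]
  have hmem : MemLp (fun ω => r ω * fourier φ ω) 2 (volume : Measure G) := by
    refine memLp_mul_of_le hrm hr (Lp.memLp _) (integrable_sqSum (Lp.memLp (fourier φ)))
      (.of_forall fun ω => ?_)
    rw [hr2]
    by_cases h : ω ∈ Φ ⁻¹' s
    · simp [h]
    · simpa [h] using sqSum_nonneg _ _
  obtain ⟨g, hg⟩ := exists_fourier_eq hmem
  have hgW : g ∈ W := mem_of_fourier_eq_mul hW hφ hr hg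
  have hbr : ∀ᵐ ω : G, bracket (fourier φ) (fourier g) ω = r ω * (Φ ω : ℂ) := by
    filter_upwards [bracket_congr (EventuallyEq.refl _ (fourier φ)) hg] with ω h1
    rw [h1, bracket_mul_right hr, bracket_self]
  have hL2 : MemLp (bracket (fourier φ) (fourier g)) 2
      ((volume : Measure G).restrict (D : Set G)) := by
    refine MemLp.of_bound
      (measurable_bracket (measurable_coe _) (measurable_coe _)).aestronglyMeasurable |K| ?_
    filter_upwards [ae_restrict_of_ae hbr] with ω hω
    rw [hω]
    by_cases h : ω ∈ Φ ⁻¹' s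
    · have h1 : Φ ω ≤ |K| := (hK _ h).trans (le_abs_self _)
      have h2 : |Φ ω| = Φ ω := abs_of_nonneg (sqSum_nonneg _ _)
      simpa [r, h, h2] using h1
    · simp [r, h]
  have hsum := (hasSum_inner_T hL2).tsum_eq
  have h1 := hab g hgW
  have hN : ‖g‖ ^ 2 = ∫ ω in (D : Set G) ∩ Φ ⁻¹' s, Φ ω := by
    rw [norm_sq_eq_integral_sqSum, ← setIntegral_indicator hE]
    refine integral_congr_ae (ae_restrict_of_ae ?_)
    filter_upwards [sqSum_congr hg] with ω h
    rw [h, sqSum_mul hr, hr2]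
    by_cases h : ω ∈ Φ ⁻¹' s <;> simp [h, Φ]
  have hsq : ∀ᵐ ω ∂(volume : Measure G).restrict (D : Set G),
      ‖bracket (fourier φ) (fourier g) ω‖ ^ 2 = (Φ ⁻¹' s).indicator (fun ω => Φ ω ^ 2) ω := by
    filter_upwards [ae_restrict_of_ae hbr] with ω hω
    rw [hω]
    by_cases h : ω ∈ Φ ⁻¹' s <;> simp [h, r]
  have hB : ∑' n : Lam, ‖inner ℂ (T n φ) g‖ ^ 2 =
      ∫ ω in (D : Set G) ∩ Φ ⁻¹' s, Φ ω ^ 2 := by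
    rw [hsum, ← setIntegral_indicator hE, integral_congr_ae hsq]
  rw [hN, hB] at h1
  refine ⟨?_, h1.2⟩
  have h3 := (memLp_two_iff_integrable_sq_norm hL2.1).1 hL2
  have h4 := h3.congr hsq
  rw [integrable_indicator_iff hE] at h4
  unfold IntegrableOn at h4 ⊢
  rwa [Measure.restrict_restrict hE, Set.inter_comm] at h4

/-- On `{0 < Φ < a}` one has `Φ² < aΦ`, against the integrated lower bound unless the set is null;
values above `b` are excluded in the same way. -/
theorem ae_eq_zero_or_mem_Icc {W : Submodule ℂ L2} (hW : IsClosed (W : Set L2)) {φ : L2}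
    (hφ : ∀ n ∈ Lam, T n φ ∈ W) {a b : ℝ}
    (hab : ∀ g ∈ W, Summable (fun n : Lam => ‖inner ℂ (T n φ) g‖ ^ 2) ∧
      a * ‖g‖ ^ 2 ≤ ∑' n : Lam, ‖inner ℂ (T n φ) g‖ ^ 2 ∧
      ∑' n : Lam, ‖inner ℂ (T n φ) g‖ ^ 2 ≤ b * ‖g‖ ^ 2) :
    ∀ᵐ ω : G, sqSum (fourier φ) ω = 0 ∨ a ≤ sqSum (fourier φ) ω ∧ sqSum (fourier φ) ω ≤ b := by
  set Φ := sqSum (fourier φ)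
  have hΦm : Measurable Φ := measurable_sqSum (measurable_coe _)
  have hΦ (ω : G) : 0 ≤ Φ ω := sqSum_nonneg _ _
  have hint (s : Set ℝ) : IntegrableOn Φ ((D : Set G) ∩ Φ ⁻¹' s) :=
    IntegrableOn.mono_set (integrable_sqSum (Lp.memLp (fourier φ))) Set.inter_subset_left
  have hmeas {s : Set ℝ} (hs : MeasurableSet s) : MeasurableSet ((D : Set G) ∩ Φ ⁻¹' s) :=
    (measurableSet_U 0).inter (hΦm hs)
  have low : ∀ᵐ ω ∂(volume : Measure G).restrict (D : Set G), ¬(0 < Φ ω ∧ Φ ω < a) := by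
    obtain ⟨h1, h2, -⟩ := frame_bounds_indicator hW hφ hab (s := Set.Ioo 0 a) measurableSet_Ioo
      (K := a) fun x hx => hx.2.le
    have h3 : ∫ ω in (D : Set G) ∩ Φ ⁻¹' Set.Ioo 0 a, (a * Φ ω - Φ ω ^ 2) ≤ 0 := by
      rw [integral_sub ((hint _).const_mul a) h1, integral_const_mul]
      linarith
    have h4 : 0 ≤ᵐ[(volume : Measure G).restrict ((D : Set G) ∩ Φ ⁻¹' Set.Ioo 0 a)]
        fun ω => a * Φ ω - Φ ω ^ 2 := by
      filter_upwards [ae_restrict_mem (hmeas measurableSet_Ioo)] with ω hω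
      have := hω.2.2
      have := hω.2.1
      simp only [Pi.zero_apply]
      nlinarith
    have h5 := (integral_eq_zero_iff_of_nonneg_ae h4 (((hint _).const_mul a).sub h1)).1
      (le_antisymm h3 (integral_nonneg_of_ae h4))
    rw [EventuallyEq, ae_restrict_iff' (hmeas measurableSet_Ioo)] at h5
    rw [ae_restrict_iff' (measurableSet_U 0)]
    filter_upwards [h5] with ω hω hD hlt
    have := hω ⟨hD, hlt⟩
    simp only [Pi.zero_apply] at this
    nlinarith [mul_pos hlt.1 (sub_pos.2 hlt.2)]
  -- No sign of `b` is assumed, hence `max b 0`; the cutoffs `K` supply the bounded sets that the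
  -- test requires and exhaust all values.
  have high : ∀ᵐ ω ∂(volume : Measure G).restrict (D : Set G),
      ∀ K : ℕ, ¬(max b 0 < Φ ω ∧ Φ ω ≤ K) := by
    refine ae_all_iff.2 fun K => ?_
    obtain ⟨h1, -, h2⟩ := frame_bounds_indicator hW hφ hab (s := Set.Ioc (max b 0) K)
      measurableSet_Ioc (K := K) fun x hx => hx.2
    have h3 : ∫ ω in (D : Set G) ∩ Φ ⁻¹' Set.Ioc (max b 0) K, (Φ ω ^ 2 - b * Φ ω) ≤ 0 := by
      rw [integral_sub h1 ((hint _).const_mul b), integral_const_mul]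
      linarith
    have h4 : 0 ≤ᵐ[(volume : Measure G).restrict ((D : Set G) ∩ Φ ⁻¹' Set.Ioc (max b 0) K)]
        fun ω => Φ ω ^ 2 - b * Φ ω := by
      filter_upwards [ae_restrict_mem (hmeas measurableSet_Ioc)] with ω hω
      have := (le_max_left b 0).trans_lt hω.2.1
      have := (le_max_right b 0).trans_lt hω.2.1
      simp only [Pi.zero_apply]
      nlinarith
    have h5 := (integral_eq_zero_iff_of_nonneg_ae h4 (h1.sub ((hint _).const_mul b))).1
      (le_antisymm h3 (integral_nonneg_of_ae h4))
    rw [EventuallyEq, ae_restrict_iff' (hmeas measurableSet_Ioc)] at h5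
    rw [ae_restrict_iff' (measurableSet_U 0)]
    filter_upwards [h5] with ω hω hD hlt
    have := hω ⟨hD, hlt⟩
    have h6 := (le_max_left b 0).trans_lt hlt.1
    have h7 := (le_max_right b 0).trans_lt hlt.1
    simp only [Pi.zero_apply] at this
    nlinarith [mul_pos h7 (sub_pos.2 h6)]
  refine ae_of_ae_D (fun ω n h => ?_) ?_
  · simpa only [Φ, isPeriodic_sqSum _ ω n n.2] using h
  · have hb : ∀ᵐ ω ∂(volume : Measure G).restrict (D : Set G), Φ ω ≤ max b 0 := by
      filter_upwards [high] with ω h2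
      obtain ⟨K, hK⟩ := exists_nat_ge (Φ ω)
      exact not_lt.1 fun h => h2 K ⟨h, hK⟩
    filter_upwards [low, hb] with ω h1 h2
    rcases (hΦ ω).eq_or_lt with h0 | h0
    · exact Or.inl h0.symm
    · refine Or.inr ⟨not_lt.1 fun h => h1 ⟨h0, h⟩, ?_⟩
      rcases le_max_iff.1 h2 with h | h
      · exact h
      · linarith

/-! ### Affine systems -/

theorem affineSystem_eq_dil (ψ : L2) (i : ℤ × Lam) : affineSystem ψ i = dil i.1 (T i.2 ψ) :=
  (dil_apply _ _).symm

theorem inner_dil_left (j : ℤ) (f g : L2) : inner ℂ (dil j f) g = inner ℂ f (dil (-j) g) := by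
  rw [← (dil (-j)).inner_map_map, dil_neg_dil]

namespace IsFMRA

variable {V : ℤ → Submodule ℂ L2} {φ : L2}

theorem dil_one_mem_iff (hV : IsFMRA V φ) (j : ℤ) (f : L2) : dil 1 f ∈ V (j + 1) ↔ f ∈ V j := by
  rw [hV.dilate j f, dil_apply]
  exact (V (j + 1)).smul_mem_iff (dilFactor_ne_zero 1)

theorem dil_mem_iff (hV : IsFMRA V φ) (i j : ℤ) (f : L2) : dil j f ∈ V (i + j) ↔ f ∈ V i := by
  induction j generalizing f with
  | zero => rw [add_zero, dil_zero]
  | succ j ih => rw [← add_assoc, add_comm (j : ℤ) 1, dil_add, hV.dil_one_mem_iff, ih]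
  | pred j ih =>
    rw [← hV.dil_one_mem_iff, ← dil_add, ← ih]
    ring_nf

theorem monotone (hV : IsFMRA V φ) : Monotone V := monotone_int_of_le_succ hV.mono

variable [∀ j, (V j).HasOrthogonalProjection]

/-- The unitary `dil (-j)` carries `V (i + j)` onto `V i`, so it intertwines the orthogonal
projections. -/
theorem starProjection_dil (hV : IsFMRA V φ) (i j : ℤ) (g : L2) :
    (V i).starProjection (dil (-j) g) = dil (-j) ((V (i + j)).starProjection g) := by
  refine Submodule.eq_starProjection_of_mem_of_inner_eq_zero ?_ fun w hw => ?_
  · rw [← hV.dil_mem_iff i j, dil_dil_neg]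
    exact Submodule.starProjection_apply_mem _ _
  · rw [← map_sub, inner_dil_left, neg_neg]
    refine Submodule.starProjection_inner_eq_zero g _ ?_
    exact (hV.dil_mem_iff i j w).2 hw

theorem tendsto_starProjection_atTop (hV : IsFMRA V φ) (g : L2) :
    Tendsto (fun k : ℕ => ‖(V k).starProjection g‖ ^ 2) atTop (𝓝 (‖g‖ ^ 2)) := by
  have h := Submodule.starProjection_tendsto_self V hV.monotone g (by
    rw [top_le_iff, ← Submodule.dense_iff_topologicalClosure_eq_top]
    exact hV.dense.mono (Set.iUnion_subset fun j => le_iSup V j))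
  exact ((h.comp tendsto_natCast_atTop_atTop).norm).pow 2

/-- The complements of `V (-k)` increase with `k`, and their span is dense because the spaces `V j`
meet only in zero. -/
theorem tendsto_starProjection_atBot (hV : IsFMRA V φ) (g : L2) :
    Tendsto (fun k : ℕ => ‖(V (-(k : ℤ))).starProjection g‖ ^ 2) atTop (𝓝 0) := by
  have h := Submodule.starProjection_tendsto_self (fun k : ℕ => (V (-(k : ℤ)))ᗮ)
    (fun k l hkl => Submodule.orthogonal_le (hV.monotone (by omega))) g (by
      rw [top_le_iff, Submodule.topologicalClosure_eq_top_iff, ← Submodule.iInf_orthogonal]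
      simp only [Submodule.orthogonal_orthogonal]
      rw [eq_bot_iff, ← hV.inter]
      refine le_iInf fun j => ?_
      exact (iInf_le _ j.natAbs).trans (hV.monotone (by omega)))
  have h2 := (h.norm.pow 2).const_sub (‖g‖ ^ 2)
  rw [sub_self] at h2
  refine h2.congr fun k => ?_
  rw [Submodule.norm_sq_eq_add_norm_sq_starProjection g (V (-(k : ℤ)))]
  ring

/-- The non-negative differences telescope to `‖g‖² - u 0` over `j ≥ 0` and to `u 0` over `j < 0`.
-/
theorem hasSum_norm_sq_sub (hV : IsFMRA V φ) (g : L2) :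
    HasSum (fun j : ℤ => ‖(V (j + 1)).starProjection g‖ ^ 2 - ‖(V j).starProjection g‖ ^ 2)
      (‖g‖ ^ 2) := by
  set u : ℤ → ℝ := fun j => ‖(V j).starProjection g‖ ^ 2
  have hmono : Monotone u := by
    intro i j hij
    have : (V i).starProjection ((V j).starProjection g) = (V i).starProjection g := by
      refine Submodule.eq_starProjection_of_mem_of_inner_eq_zero
        (Submodule.starProjection_apply_mem _ _) fun w hw => ?_
      rw [← sub_sub_sub_cancel_left _ _ g, inner_sub_left,
        Submodule.starProjection_inner_eq_zero g w hw,
        Submodule.starProjection_inner_eq_zero g w (hV.monotone hij hw), sub_zero]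
    simp only [u]
    rw [← this]
    gcongr
    exact Submodule.norm_starProjection_apply_le _ _
  have h1 : HasSum (fun n : ℕ => u ((n : ℤ) + 1) - u n) (‖g‖ ^ 2 - u 0) := by
    rw [hasSum_iff_tendsto_nat_of_nonneg fun n => sub_nonneg.2 (hmono (by omega))]
    refine ((hV.tendsto_starProjection_atTop g).sub_const (u 0)).congr fun k => ?_
    exact_mod_cast (Finset.sum_range_sub (fun n : ℕ => u n) k).symm
  have h2 : HasSum (fun n : ℕ => u (-((n : ℤ) + 1) + 1) - u (-((n : ℤ) + 1))) (u 0) := by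
    rw [hasSum_iff_tendsto_nat_of_nonneg fun n => sub_nonneg.2 (hmono (by omega))]
    have := (hV.tendsto_starProjection_atBot g).const_sub (u 0)
    rw [sub_zero] at this
    refine this.congr fun k => ?_
    have h := Finset.sum_range_sub' (fun n : ℕ => u (-(n : ℤ))) k
    simp only [Nat.cast_zero, neg_zero] at h
    rw [← h]
    refine Finset.sum_congr rfl fun n _ => ?_
    rw [neg_add_rev, neg_add_cancel_comm, Nat.cast_add, Nat.cast_one, neg_add_rev]
  have h := HasSum.of_nat_of_neg_add_one (f := fun j : ℤ => u (j + 1) - u j) h1 h2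
  rwa [sub_add_cancel] at h

/-- At level `j` the coefficients of `g` are those of the component `q` in `W₀` of `dil (-j) g`, and
`‖q‖²` is the `j`-th telescoping difference. Summing over `j` keeps both frame constants. -/
theorem isFrameFor_affineSystem (hV : IsFMRA V φ) {ψ : L2}
    (hψ : IsFrameFor (fun n : Lam => T n ψ) (V 1 ⊓ (V 0)ᗮ)) : IsFrameFor (affineSystem ψ) ⊤ := by
  obtain ⟨hmem, a, b, ha, hab, hfr⟩ := hψ
  refine ⟨fun _ => Submodule.mem_top, a, b, ha, hab, fun g _ => ?_⟩
  set d : ℤ → ℝ := fun j => ‖(V (j + 1)).starProjection g‖ ^ 2 - ‖(V j).starProjection g‖ ^ 2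
  have key (j : ℤ) : Summable (fun n : Lam => ‖inner ℂ (affineSystem ψ (j, n)) g‖ ^ 2) ∧
      a * d j ≤ ∑' n : Lam, ‖inner ℂ (affineSystem ψ (j, n)) g‖ ^ 2 ∧
      ∑' n : Lam, ‖inner ℂ (affineSystem ψ (j, n)) g‖ ^ 2 ≤ b * d j := by
    set h := dil (-j) g
    set q := (V 1).starProjection h - (V 0).starProjection h
    have h01 : V 0 ≤ V 1 := hV.monotone zero_le_one
    have hqV : q ∈ V 1 := (V 1).sub_mem (Submodule.starProjection_apply_mem _ _)
      (h01 (Submodule.starProjection_apply_mem _ _))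
    have hq0 : q ∈ (V 0)ᗮ := by
      intro w hw
      rw [← inner_conj_symm]
      simp only [q]
      rw [← sub_sub_sub_cancel_left _ _ h, inner_sub_left,
        Submodule.starProjection_inner_eq_zero h w hw,
        Submodule.starProjection_inner_eq_zero h w (h01 hw), sub_zero, map_zero]
    have hq : ‖q‖ ^ 2 = d j := by
      have e : (V 1).starProjection h = q + (V 0).starProjection h := by simp [q]
      have e1 := norm_add_sq_eq_norm_sq_add_norm_sq_of_inner_eq_zero q
        ((V 0).starProjection h) (𝕜 := ℂ) (by
          rw [← inner_conj_symm, hq0 _ (Submodule.starProjection_apply_mem _ _), map_zero])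
      rw [← e] at e1
      simp only [d]
      have hn (i : ℤ) : ‖(V (i + j)).starProjection g‖ = ‖(V i).starProjection h‖ := by
        rw [← LinearIsometryEquiv.norm_map (dil (-j)), ← hV.starProjection_dil]
      have h0 := hn 0
      have h1 := hn 1
      simp only [zero_add, add_comm (1 : ℤ)] at h0 h1
      rw [h0, h1]
      linarith
    have hin (n : Lam) : inner ℂ (affineSystem ψ (j, n)) g = inner ℂ (T n ψ) q := by
      rw [affineSystem_eq_dil, inner_dil_left]
      have e1 : inner ℂ (T n ψ) (h - (V 1).starProjection h) = 0 := by
        rw [← inner_conj_symm, Submodule.starProjection_inner_eq_zero h _ (hmem n).1, map_zero]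
      have e2 : inner ℂ (T n ψ) ((V 0).starProjection h) = 0 := by
        rw [← inner_conj_symm, (hmem n).2 _ (Submodule.starProjection_apply_mem _ _), map_zero]
      rw [inner_sub_right, sub_eq_zero] at e1
      simp only [q]
      rw [inner_sub_right, e2, sub_zero, ← e1]
    simp only [hin, ← hq]
    exact hfr q ⟨hqV, hq0⟩
  have hd := hV.hasSum_norm_sq_sub g
  have hA : Summable fun j : ℤ => ∑' n : Lam, ‖inner ℂ (affineSystem ψ (j, n)) g‖ ^ 2 :=
    Summable.of_nonneg_of_le (fun j => tsum_nonneg fun n => by positivity)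
      (fun j => (key j).2.2) (hd.summable.mul_left b)
  have hS : Summable fun i : ℤ × Lam => ‖inner ℂ (affineSystem ψ i) g‖ ^ 2 :=
    (summable_prod_of_nonneg fun i => by positivity).2 ⟨fun j => (key j).1, hA⟩
  refine ⟨hS, ?_, ?_⟩
  · rw [hS.tsum_prod' fun j => (key j).1, ← hd.tsum_eq, ← tsum_mul_left]
    exact (hd.summable.mul_left a).tsum_le_tsum (fun j => (key j).2.1) hA
  · rw [hS.tsum_prod' fun j => (key j).1, ← hd.tsum_eq, ← tsum_mul_left]
    exact hA.tsum_le_tsum (fun j => (key j).2.2) (hd.summable.mul_left b)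

end IsFMRA

/-! ### Splitting sums over `Λ` -/

/-- The element `ρ n` of `Λ₁`. -/
def evenLam (n : Lam) : Lam := ⟨ρ n, fun j hj => n.2 (j + 1) (by omega)⟩

/-- The element `ρ (n + 0.1)` of `Λ ∖ Λ₁`. -/
def oddLam (n : Lam) : Lam := ⟨ρ (n + pointOne), fun j hj => by
  rw [shift_apply, add_apply, n.2 (j + 1) (by omega), pointOne_apply, if_neg (by omega), add_zero]⟩

theorem evenLam_zero (n : Lam) : (evenLam n : G) 0 = 0 := n.2 1 one_pos

theorem oddLam_zero (n : Lam) : (oddLam n : G) 0 = 1 := by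
  change ((n : G) + pointOne) (0 + 1) = 1
  rw [add_apply, n.2 _ (by norm_num), pointOne_apply, if_pos (by norm_num), zero_add]

theorem evenLam_injective : Function.Injective evenLam := fun _ _ h =>
  Subtype.ext (ρ.injective (congrArg Subtype.val h))

theorem oddLam_injective : Function.Injective oddLam := fun _ _ h =>
  Subtype.ext (add_right_cancel (ρ.injective (congrArg Subtype.val h)))

theorem exists_evenLam_eq {n : Lam} (h : (n : G) 0 = 0) : ∃ k, evenLam k = n :=
  ⟨⟨σ n, fun j hj => by
    rw [shift_apply]
    rcases (show (1 : ℤ) ≤ j from hj).eq_or_lt with rfl | h1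
    · exact h
    · exact n.2 _ (by omega)⟩, Subtype.ext (ρ_σ _)⟩

theorem exists_oddLam_eq {n : Lam} (h : (n : G) 0 ≠ 0) : ∃ k, oddLam k = n := by
  have h2 : ∀ a : ZMod 2, a ≠ 0 → a = 1 := by decide
  refine ⟨⟨σ n + pointOne, fun j hj => ?_⟩, Subtype.ext ?_⟩
  · rw [add_apply, shift_apply, pointOne_apply]
    rcases (show (1 : ℤ) ≤ j from hj).eq_or_lt with rfl | h1
    · rw [if_pos rfl, show (1 : ℤ) + -1 = 0 by norm_num, h2 _ h]
      exact CharTwo.add_self_eq_zero 1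
    · rw [if_neg (by omega), n.2 _ (by omega), add_zero]
  · change ρ (σ n + pointOne + pointOne) = n
    rw [add_assoc, add_self, add_zero, ρ_σ]

theorem isCompl_range : IsCompl (Set.range evenLam) (Set.range oddLam) := by
  refine ⟨Set.disjoint_left.2 ?_, codisjoint_iff.2 ?_⟩
  · rintro _ ⟨k, rfl⟩ ⟨l, hl⟩
    have := evenLam_zero k
    rw [← hl, oddLam_zero] at this
    exact one_ne_zero this
  · refine Set.eq_univ_of_forall fun n => ?_
    by_cases h : (n : G) 0 = 0
    · exact Or.inl (exists_evenLam_eq h)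
    · exact Or.inr (exists_oddLam_eq h)

theorem hasSum_of_even_odd {u : Lam → ℂ} {a b : ℂ} (ha : HasSum (fun n => u (evenLam n)) a)
    (hb : HasSum (fun n => u (oddLam n)) b) : HasSum u (a + b) :=
  ((evenLam_injective.hasSum_range_iff).2 ha).add_isCompl isCompl_range
    ((oddLam_injective.hasSum_range_iff).2 hb)

/-- `σ` maps `Λ₁` onto `Λ` and the other coset onto `0.1 + Λ`; thus a sum over `ω + Λ` of a function
of `σ` splits into sums over the cosets of `σ ω` and `σ ω + 0.1`. -/
theorem σ_add_evenLam (ω : G) (n : Lam) : σ (ω + evenLam n) = σ ω + n := by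
  rw [map_add]
  exact congrArg _ (σ_ρ n)

theorem σ_add_oddLam (ω : G) (n : Lam) : σ (ω + oddLam n) = σ ω + pointOne + n := by
  rw [map_add, add_assoc, add_comm pointOne]
  exact congrArg _ (σ_ρ _)

theorem hasSum_conj_mul {r t f : G → ℂ} (hr : IsPeriodic r) (ht : IsPeriodic t) {ω : G}
    (h : SqSummable f ω) :
    HasSum (fun n : Lam => starRingEnd ℂ (r (ω + n) * f (ω + n)) * (t (ω + n) * f (ω + n)))
      (starRingEnd ℂ (r ω) * t ω * sqSum f ω) := by
  have h1 : HasSum (fun n : Lam => ((‖f (ω + n)‖ ^ 2 : ℝ) : ℂ)) (sqSum f ω : ℂ) :=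
    Complex.hasSum_ofReal.2 (Summable.hasSum h)
  refine (h1.mul_left _).congr_fun fun n => ?_
  rw [hr ω n n.2, ht ω n n.2, map_mul]
  push_cast
  rw [← Complex.conj_mul']
  ring

theorem bracket_comp_σ {r t f : G → ℂ} (hr : IsPeriodic r) (ht : IsPeriodic t) {ω : G}
    (h0 : SqSummable f (σ ω)) (h1 : SqSummable f (σ ω + pointOne)) :
    bracket (fun ω => r (σ ω) * f (σ ω)) (fun ω => t (σ ω) * f (σ ω)) ω =
      starRingEnd ℂ (r (σ ω)) * t (σ ω) * sqSum f (σ ω) +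
        starRingEnd ℂ (r (σ ω + pointOne)) * t (σ ω + pointOne) * sqSum f (σ ω + pointOne) := by
  refine (hasSum_of_even_odd ?_ ?_).tsum_eq
  · simpa only [σ_add_evenLam] using hasSum_conj_mul hr ht h0
  · simpa only [σ_add_oddLam] using hasSum_conj_mul hr ht h1

theorem sqSum_comp_σ {r f : G → ℂ} (hr : IsPeriodic r) {ω : G}
    (h0 : SqSummable f (σ ω)) (h1 : SqSummable f (σ ω + pointOne)) :
    sqSum (fun ω => r (σ ω) * f (σ ω)) ω =
      ‖r (σ ω)‖ ^ 2 * sqSum f (σ ω) + ‖r (σ ω + pointOne)‖ ^ 2 * sqSum f (σ ω + pointOne) := by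
  have h := bracket_comp_σ hr hr h0 h1
  rw [bracket_self, Complex.conj_mul', Complex.conj_mul'] at h
  exact_mod_cast h

theorem sqSum_ne_zero_iff {f : G → ℂ} {ω : G} (h : SqSummable f ω) :
    sqSum f ω ≠ 0 ↔ ∃ n : Lam, f (ω + n) ≠ 0 := by
  rw [sqSum, ← not_iff_not, not_not, ← Summable.hasSum_iff h,
    hasSum_zero_iff_of_nonneg fun n => by positivity]
  simp [funext_iff]

theorem mem_Delta2_iff {f : G → ℂ} {ω : G} (h0 : SqSummable f (σ ω))
    (h1 : SqSummable f (σ ω + pointOne)) :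
    ω ∈ Delta2 f ↔ ω ∈ D ∧ sqSum f (σ ω) ≠ 0 ∧ sqSum f (σ ω + pointOne) ≠ 0 := by
  rw [sqSum_ne_zero_iff h0, sqSum_ne_zero_iff h1]
  refine and_congr_right fun _ => and_congr ?_ ?_
  · rw [ne_eq, ENNReal.tsum_eq_zero, not_forall]
    constructor
    · rintro ⟨⟨n, hn, hn0⟩, h⟩
      obtain ⟨k, hk⟩ := exists_evenLam_eq (n := ⟨n, hn⟩) hn0
      refine ⟨k, fun h' => h ?_⟩
      rw [← σ_add_evenLam, hk] at h'
      rw [h']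
      simp
    · rintro ⟨k, hk⟩
      refine ⟨⟨evenLam k, (evenLam k).2, evenLam_zero k⟩, ?_⟩
      simpa [← σ_add_evenLam] using hk
  · rw [ne_eq, ENNReal.tsum_eq_zero, not_forall]
    constructor
    · rintro ⟨⟨n, hn, hn0⟩, h⟩
      obtain ⟨k, hk⟩ := exists_oddLam_eq (n := ⟨n, hn⟩) hn0
      refine ⟨k, fun h' => h ?_⟩
      rw [← σ_add_oddLam, hk] at h'
      rw [h']
      simp
    · rintro ⟨k, hk⟩
      refine ⟨⟨oddLam k, (oddLam k).2, by rw [oddLam_zero]; exact one_ne_zero⟩, ?_⟩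
      simpa [← σ_add_oddLam] using hk

theorem Delta2_congr {f g : G → ℂ} (h : f =ᵐ[volume] g) :
    ∀ᵐ ω : G, ω ∈ Delta2 f ↔ ω ∈ Delta2 g := by
  filter_upwards [ae_add_Lam ((quasiMeasurePreserving_shift (-1)).ae h)] with ω hω
  refine and_congr_right fun _ => and_congr ?_ ?_
  · rw [tsum_congr fun n : {n : G // n ∈ Lam ∧ n 0 = 0} => by rw [hω ⟨n, n.2.1⟩]]
  · rw [tsum_congr fun n : {n : G // n ∈ Lam ∧ n 0 ≠ 0} => by rw [hω ⟨n, n.2.1⟩]]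

theorem ae_add_right {P : G → Prop} (h : ∀ᵐ ω : G, P ω) (x : G) : ∀ᵐ ω : G, P (ω + x) :=
  (measurePreserving_add_right volume x).quasiMeasurePreserving.ae h

theorem ae_σ {P : G → Prop} (h : ∀ᵐ ω : G, P ω) : ∀ᵐ ω : G, P (σ ω) :=
  (quasiMeasurePreserving_shift (-1)).ae h

theorem ae_σ_add_pointOne {P : G → Prop} (h : ∀ᵐ ω : G, P ω) :
    ∀ᵐ ω : G, P (σ ω + pointOne) :=
  ae_σ (P := fun ω => P (ω + pointOne)) (ae_add_right h pointOne)

/-! ### Symbols of the elements of `V 1` -/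

/-- `r` is a `Λ`-periodic symbol of `f` with respect to `φ`. -/
def HasSymbol (φ f : L2) (r : G → ℂ) : Prop :=
  Measurable r ∧ IsPeriodic r ∧
    fourier f =ᵐ[volume] fun ω => r (σ ω) * fourier φ (σ ω)

theorem HasSymbol.bracket_eq {φ f g : L2} {r t : G → ℂ} (hf : HasSymbol φ f r)
    (hg : HasSymbol φ g t) : ∀ᵐ ω : G, bracket (fourier f) (fourier g) ω =
      starRingEnd ℂ (r (σ ω)) * t (σ ω) * sqSum (fourier φ) (σ ω) +
        starRingEnd ℂ (r (σ ω + pointOne)) * t (σ ω + pointOne)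
          * sqSum (fourier φ) (σ ω + pointOne) := by
  have h := ae_sqSummable (Lp.memLp (fourier φ))
  filter_upwards [bracket_congr hf.2.2 hg.2.2, ae_σ h, ae_σ_add_pointOne h] with ω e h0 h1
  rw [e, bracket_comp_σ hf.2.1 hg.2.1 h0 h1]

theorem HasSymbol.sqSum_eq {φ f : L2} {r : G → ℂ} (hf : HasSymbol φ f r) :
    ∀ᵐ ω : G, sqSum (fourier f) ω = ‖r (σ ω)‖ ^ 2 * sqSum (fourier φ) (σ ω) +
        ‖r (σ ω + pointOne)‖ ^ 2 * sqSum (fourier φ) (σ ω + pointOne) := by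
  have h := ae_sqSummable (Lp.memLp (fourier φ))
  filter_upwards [sqSum_congr hf.2.2, ae_σ h, ae_σ_add_pointOne h] with ω e h0 h1
  rw [e, sqSum_comp_σ hf.2.1 h0 h1]

theorem HasSymbol.translate {φ f : L2} {r : G → ℂ} (hf : HasSymbol φ f r) (n : Lam) :
    HasSymbol φ (T n f) fun ω => χ (ρ n) ω * r ω := by
  refine ⟨(continuous_χ_right _).measurable.mul hf.1, fun ω k hk => ?_, ?_⟩
  · beta_reduce
    rw [hf.2.1 ω k hk, isPeriodic_χ (show ρ (n : G) ∈ Lam from (evenLam n).2) ω k hk]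
  · filter_upwards [fourier_T n.2 f, hf.2.2] with ω h1 h2
    rw [h1, h2, χ_shift 1, ρ_σ, mul_assoc]

theorem fourier_smul_compShift_one (f : L2) :
    fourier ((2 : ℂ) • compShift 1 f) =ᵐ[volume] fun ω => fourier f (σ ω) := by
  rw [map_smul, fourier_compShift_one, smul_smul]
  norm_num
  exact coeFn_compShift _ _

namespace IsFMRA

variable {V : ℤ → Submodule ℂ L2} {φ : L2}

theorem exists_hasSymbol (hV : IsFMRA V φ) {r : G → ℂ} (hrm : Measurable r) (hr : IsPeriodic r)
    {C : ℝ} (hC : ∀ᵐ ω : G, ‖r ω‖ ^ 2 * sqSum (fourier φ) ω ≤ C) :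
    ∃ f ∈ V 1, HasSymbol φ f r := by
  obtain ⟨g, hg⟩ := exists_fourier_eq (memLp_mul_of_le hrm hr (Lp.memLp (fourier φ))
    (integrable_const C) (ae_restrict_of_ae hC))
  have hg0 : g ∈ V 0 := mem_of_fourier_eq_mul (hV.closed 0) (fun n hn => hV.frame.1 ⟨n, hn⟩) hr hg
  refine ⟨(2 : ℂ) • compShift 1 g, (V 1).smul_mem _ ((hV.dilate 0 g).1 hg0), hrm, hr, ?_⟩
  filter_upwards [fourier_smul_compShift_one g, ae_σ hg] with ω h1 h2
  rw [h1, h2]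

theorem hasSymbol_of_mem (hV : IsFMRA V φ) {f : L2} (hf : f ∈ V 1) :
    ∃ r, HasSymbol φ f r := by
  set g : L2 := (2⁻¹ : ℂ) • compShift (-1) f
  have hfg : f = (2 : ℂ) • compShift 1 g := by
    simp only [g]
    rw [compShift_smul, compShift_compShift, neg_add_cancel, compShift_zero, smul_smul]
    norm_num
  have hg : g ∈ V 0 := by
    rw [hV.dilate 0 g]
    rw [hfg] at hf
    exact ((V 1).smul_mem_iff two_ne_zero).1 hf
  obtain ⟨r, hrm, hr, h⟩ := exists_fourier_eq_mul_of_mem (hV.closed 0) hV.frame hg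
  refine ⟨r, hrm, hr, ?_⟩
  filter_upwards [fourier_smul_compShift_one g, ae_σ h] with ω h1 h2
  rw [hfg, h1, h2]

theorem mem_of_hasSymbol (hV : IsFMRA V φ) {f : L2} {r : G → ℂ} (hf : HasSymbol φ f r) :
    f ∈ V 1 := by
  set g : L2 := (2⁻¹ : ℂ) • compShift (-1) f
  have hfg : f = (2 : ℂ) • compShift 1 g := by
    simp only [g]
    rw [compShift_smul, compShift_compShift, neg_add_cancel, compShift_zero, smul_smul]
    norm_num
  have hg : fourier g =ᵐ[volume] fun ω => r ω * fourier φ ω := by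
    have h := fourier_smul_compShift_one g
    rw [← hfg] at h
    filter_upwards [(quasiMeasurePreserving_shift 1).ae h,
      (quasiMeasurePreserving_shift 1).ae hf.2.2] with ω h1 h2
    simpa only [σ_ρ] using h1.symm.trans h2
  rw [hfg]
  exact (V 1).smul_mem _ ((hV.dilate 0 g).1 (mem_of_fourier_eq_mul (hV.closed 0)
    (fun n hn => hV.frame.1 ⟨n, hn⟩) hf.2.1 hg))

/-- For the converse, the projection of `f` to `V 0` is again orthogonal to all translates of `φ`,
hence zero by the lower frame bound. -/
theorem mem_orthogonal_iff (hV : IsFMRA V φ) {f : L2} : f ∈ (V 0)ᗮ ↔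
    bracket (fourier φ) (fourier f) =ᵐ[(volume : Measure G).restrict (D : Set G)] 0 := by
  have : CompleteSpace (V 0) := (hV.closed 0).completeSpace_coe
  constructor
  · intro h
    exact bracket_eq_zero_of_forall_inner_T fun n hn => h _ (hV.frame.1 ⟨n, hn⟩)
  · intro h
    have h1 : (V 0).starProjection f = 0 := by
      refine hV.frame.eq_zero (Submodule.starProjection_apply_mem _ _) fun n => ?_
      have e := Submodule.starProjection_inner_eq_zero f _ (hV.frame.1 n)
      rw [inner_sub_left, ← inner_conj_symm, inner_T_eq_zero_of_bracket h n.2, map_zero, zero_sub,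
        neg_eq_zero] at e
      rw [← inner_conj_symm, e, map_zero]
    have h2 := Submodule.sub_starProjection_mem_orthogonal (K := V 0) f
    rwa [h1, sub_zero] at h2

end IsFMRA

/-! ### The fibre of the wavelet space -/

/-- The Lagrange identity for the weights `S`, `R`. -/
theorem lagrange_identity (m₀ m₁ t₀ t₁ : ℂ) (S R : ℝ) :
    (‖m₀‖ ^ 2 * S + ‖m₁‖ ^ 2 * R) * (‖t₀‖ ^ 2 * S + ‖t₁‖ ^ 2 * R) =
      ‖starRingEnd ℂ m₀ * t₀ * S + starRingEnd ℂ m₁ * t₁ * R‖ ^ 2 +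
        S * R * ‖m₁ * t₀ - m₀ * t₁‖ ^ 2 := by
  simp only [Complex.sq_norm, Complex.normSq_apply, Complex.add_re, Complex.add_im,
    Complex.sub_re, Complex.sub_im, Complex.mul_re, Complex.mul_im, Complex.conj_re,
    Complex.conj_im, Complex.ofReal_re, Complex.ofReal_im]
  ring

open Classical in
/-- The symbol of the wavelet at a point, in terms of the low-pass filter and the periodization
of the scaling function at this point (`m₀`, `S`) and at its translate by `0.1` (`m₁`, `R`). -/
noncomputable def waveletSymbol (s m₀ m₁ : ℂ) (S R : ℝ) : ℂ :=
  if S = 0 then 0 else if R = 0 then (if m₀ = 0 then 1 else 0) else s * starRingEnd ℂ m₁ * R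

/-- The second term carries the symbol at the translate by `0.1`, where the two points change roles
and the sign character `s` changes sign. Generically the vector is `(s m̄₁ R, -s m̄₀ S)`; if one
weight vanishes, the remaining coordinate is non-zero only where its filter value is zero. -/
theorem waveletSymbol_orthogonal (s m₀ m₁ : ℂ) (S R : ℝ) :
    starRingEnd ℂ m₀ * waveletSymbol s m₀ m₁ S R * S +
      starRingEnd ℂ m₁ * waveletSymbol (-s) m₁ m₀ R S * R = 0 := by
  unfold waveletSymbol
  by_cases hS : S = 0 <;> by_cases hR : R = 0
  · simp [hS, hR]
  · by_cases h : m₁ = 0 <;> simp [hS, hR, h]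
  · by_cases h : m₀ = 0 <;> simp [hS, hR, h]
  · simp only [hS, hR, if_false]
    ring

theorem waveletSymbol_frame {a b : ℝ} (ha : 0 < a) {s m₀ m₁ t₀ t₁ : ℂ} (hs : ‖s‖ = 1) {S R : ℝ}
    (hS : S = 0 ∨ a ≤ S ∧ S ≤ b) (hR : R = 0 ∨ a ≤ R ∧ R ≤ b)
    (hP : ‖m₀‖ ^ 2 * S + ‖m₁‖ ^ 2 * R = 0 ∨
      a ≤ ‖m₀‖ ^ 2 * S + ‖m₁‖ ^ 2 * R ∧ ‖m₀‖ ^ 2 * S + ‖m₁‖ ^ 2 * R ≤ b)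
    (hm : S ≠ 0 → R ≠ 0 → ¬(m₀ = 0 ∧ m₁ = 0))
    (ht : starRingEnd ℂ m₀ * t₀ * S + starRingEnd ℂ m₁ * t₁ * R = 0) :
    min a (a ^ 3) * (‖t₀‖ ^ 2 * S + ‖t₁‖ ^ 2 * R) ≤
        ‖starRingEnd ℂ (waveletSymbol s m₀ m₁ S R) * t₀ * S +
          starRingEnd ℂ (waveletSymbol (-s) m₁ m₀ R S) * t₁ * R‖ ^ 2 ∧
      ‖starRingEnd ℂ (waveletSymbol s m₀ m₁ S R) * t₀ * S +
          starRingEnd ℂ (waveletSymbol (-s) m₁ m₀ R S) * t₁ * R‖ ^ 2 ≤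
        max b (b ^ 3) * (‖t₀‖ ^ 2 * S + ‖t₁‖ ^ 2 * R) := by
  -- One-dimensional fibre: either `m = 0` and the squared bracket is `Q` times the norm squared, or
  -- orthogonality forces `t = 0`.
  have one {m t : ℂ} {Q : ℝ} (hQ0 : Q ≠ 0) (hQ : Q = 0 ∨ a ≤ Q ∧ Q ≤ b)
      (h : starRingEnd ℂ m * t * Q = 0) {w : ℂ} (hw : w = if m = 0 then 1 else 0) :
      min a (a ^ 3) * (‖t‖ ^ 2 * Q) ≤ ‖starRingEnd ℂ w * t * Q‖ ^ 2 ∧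
        ‖starRingEnd ℂ w * t * Q‖ ^ 2 ≤ max b (b ^ 3) * (‖t‖ ^ 2 * Q) := by
    obtain ⟨h1, h2⟩ := hQ.resolve_left hQ0
    have hQp : 0 < Q := ha.trans_le h1
    by_cases hm0 : m = 0
    · rw [if_pos hm0] at hw
      have e : ‖starRingEnd ℂ w * t * Q‖ ^ 2 = Q * (‖t‖ ^ 2 * Q) := by
        rw [hw, map_one, one_mul, norm_mul, Complex.norm_real, Real.norm_of_nonneg hQp.le]
        ring
      rw [e]
      exact ⟨mul_le_mul_of_nonneg_right ((min_le_left _ _).trans h1) (by positivity),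
        mul_le_mul_of_nonneg_right (h2.trans (le_max_left _ _)) (by positivity)⟩
    · have ht0 : t = 0 := by
        have hQ' : (Q : ℂ) ≠ 0 := by exact_mod_cast hQ0
        simpa [hm0, hQ'] using h
      simp [ht0]
  by_cases hS0 : S = 0 <;> by_cases hR0 : R = 0
  · simp [hS0, hR0]
  · have h := one hR0 hR (m := m₁) (t := t₁) (by simpa [hS0] using ht)
      (w := waveletSymbol (-s) m₁ m₀ R S) (by simp [waveletSymbol, hS0, hR0])
    simpa [hS0] using h
  · have h := one hS0 hS (m := m₀) (t := t₀) (by simpa [hR0] using ht)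
      (w := waveletSymbol s m₀ m₁ S R) (by simp [waveletSymbol, hS0, hR0])
    simpa [hR0] using h
  · obtain ⟨hS1, hS2⟩ := hS.resolve_left hS0
    obtain ⟨hR1, hR2⟩ := hR.resolve_left hR0
    have hSp := ha.trans_le hS1
    have hRp := ha.trans_le hR1
    set P := ‖m₀‖ ^ 2 * S + ‖m₁‖ ^ 2 * R
    set N := ‖t₀‖ ^ 2 * S + ‖t₁‖ ^ 2 * R
    have hN : 0 ≤ N := by positivity
    have hP0 : P ≠ 0 := by
      intro h
      have h0 : 0 ≤ ‖m₀‖ ^ 2 * S := by positivity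
      have h1 : 0 ≤ ‖m₁‖ ^ 2 * R := by positivity
      have h2 : ‖m₀‖ ^ 2 * S = 0 := by simp only [P] at h; linarith
      have h3 : ‖m₁‖ ^ 2 * R = 0 := by simp only [P] at h; linarith
      exact hm hS0 hR0 ⟨by simpa [hS0] using h2, by simpa [hR0] using h3⟩
    obtain ⟨hP1, hP2⟩ := hP.resolve_left hP0
    have hPp := ha.trans_le hP1
    have hl := lagrange_identity m₀ m₁ t₀ t₁ S R
    rw [ht, norm_zero, zero_pow two_ne_zero, zero_add] at hl
    -- The bracket is `s̄ (m₁ t₀ - m₀ t₁) S R`; since `t` is orthogonal to `m`, the Lagrange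
    -- identity reads `P N = S R |m₁ t₀ - m₀ t₁|²`. Three factors in `[a, b]` remain in front of
    -- `N`.
    have e : ‖starRingEnd ℂ (waveletSymbol s m₀ m₁ S R) * t₀ * S +
        starRingEnd ℂ (waveletSymbol (-s) m₁ m₀ R S) * t₁ * R‖ ^ 2 = S * R * P * N := by
      have e1 : starRingEnd ℂ (waveletSymbol s m₀ m₁ S R) * t₀ * S +
          starRingEnd ℂ (waveletSymbol (-s) m₁ m₀ R S) * t₁ * R =
          starRingEnd ℂ s * (m₁ * t₀ - m₀ * t₁) * S * R := by
        simp only [waveletSymbol, hS0, hR0, if_false, map_mul, map_neg, Complex.conj_conj,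
          Complex.conj_ofReal]
        ring
      rw [e1, norm_mul, norm_mul, norm_mul, RCLike.norm_conj, hs, Complex.norm_real,
        Complex.norm_real, Real.norm_of_nonneg hSp.le, Real.norm_of_nonneg hRp.le]
      change P * N = _ at hl
      linear_combination (-S * R) * hl
    rw [e]
    have hlow : a ^ 3 ≤ S * R * P := by
      calc a ^ 3 = a * a * a := by ring
        _ ≤ S * R * P := by gcongr
    have hb : 0 ≤ b := ha.le.trans (hS1.trans hS2)
    have hhigh : S * R * P ≤ b ^ 3 := by
      calc S * R * P ≤ b * b * b := by gcongr
        _ = b ^ 3 := by ring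
    exact ⟨mul_le_mul_of_nonneg_right ((min_le_right _ _).trans hlow) hN,
      mul_le_mul_of_nonneg_right (hhigh.trans (le_max_right _ _)) hN⟩

theorem add_pointOne_add_pointOne (ω : G) : ω + pointOne + pointOne = ω := by
  rw [add_assoc, add_self, add_zero]

theorem χ_single_zero_add_pointOne (ω : G) :
    χ (single 0) (ω + pointOne) = -χ (single 0) ω := by
  rw [χ_add_right, χ_single, χ_single, pointOne_apply]
  simp [ZMod.val_one]

/-! ### Existence of frame wavelets -/

/-- A measurable periodic low-pass filter of `φ`. -/
def IsFilter (φ : L2) (m : G → ℂ) : Prop := HasSymbol φ φ m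

namespace IsFMRA

variable {V : ℤ → Submodule ℂ L2} {φ : L2} {m : G → ℂ}

theorem exists_bounds (hV : IsFMRA V φ) : ∃ a b : ℝ, 0 < a ∧ a ≤ b ∧
    ∀ᵐ ω : G, sqSum (fourier φ) ω = 0 ∨ a ≤ sqSum (fourier φ) ω ∧ sqSum (fourier φ) ω ≤ b := by
  obtain ⟨hmem, a, b, ha, hab, h⟩ := hV.frame
  exact ⟨a, b, ha, hab, ae_eq_zero_or_mem_Icc (hV.closed 0) (fun n hn => hmem ⟨n, hn⟩) h⟩

theorem mem_wavelet_iff (hV : IsFMRA V φ) (hm : IsFilter φ m) {f : L2} {r : G → ℂ}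
    (hf : HasSymbol φ f r) : f ∈ V 1 ⊓ (V 0)ᗮ ↔
      ∀ᵐ ω ∂(volume : Measure G).restrict (D : Set G),
        starRingEnd ℂ (m (σ ω)) * r (σ ω) * sqSum (fourier φ) (σ ω) +
        starRingEnd ℂ (m (σ ω + pointOne)) * r (σ ω + pointOne)
          * sqSum (fourier φ) (σ ω + pointOne) = 0 := by
  rw [Submodule.mem_inf, and_iff_right (hV.mem_of_hasSymbol hf), hV.mem_orthogonal_iff]
  refine eventually_congr ?_
  filter_upwards [ae_restrict_of_ae (hm.bracket_eq hf)] with ω h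
  rw [h, Pi.zero_apply]

theorem translate_mem_wavelet (hV : IsFMRA V φ) {f : L2} (hf : f ∈ V 1 ⊓ (V 0)ᗮ) (n : Lam) :
    T n f ∈ V 1 ⊓ (V 0)ᗮ := by
  obtain ⟨r, hr⟩ := hV.hasSymbol_of_mem hf.1
  refine ⟨hV.mem_of_hasSymbol (hr.translate n), hV.mem_orthogonal_iff.2 ?_⟩
  filter_upwards [hV.mem_orthogonal_iff.1 hf.2,
    ae_restrict_of_ae (bracket_congr (EventuallyEq.refl _ (fourier φ)) (fourier_T n.2 f))]
    with ω h1 h2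
  rw [h2, bracket_mul_right (isPeriodic_χ n.2), h1, Pi.zero_apply, mul_zero]

/-- Orthogonality to `m` puts the element with symbol `t` into `W₀`; orthogonality to `r` makes it
orthogonal to all translates of `ψ`, so the frame property forces it to be zero. -/
theorem symbol_eq_zero (hV : IsFMRA V φ) (hm : IsFilter φ m) {ψ : L2}
    (hψ : IsFrameFor (fun n : Lam => T n ψ) (V 1 ⊓ (V 0)ᗮ)) {r : G → ℂ} (hr : HasSymbol φ ψ r)
    {t : G → ℂ} (htm : Measurable t) (ht : IsPeriodic t) {C : ℝ}
    (hC : ∀ᵐ ω : G, ‖t ω‖ ^ 2 * sqSum (fourier φ) ω ≤ C)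
    (h1 : ∀ᵐ ω ∂(volume : Measure G).restrict (D : Set G),
        starRingEnd ℂ (m (σ ω)) * t (σ ω) * sqSum (fourier φ) (σ ω) +
        starRingEnd ℂ (m (σ ω + pointOne)) * t (σ ω + pointOne)
          * sqSum (fourier φ) (σ ω + pointOne) = 0)
    (h2 : ∀ᵐ ω ∂(volume : Measure G).restrict (D : Set G),
        starRingEnd ℂ (r (σ ω)) * t (σ ω) * sqSum (fourier φ) (σ ω) +
        starRingEnd ℂ (r (σ ω + pointOne)) * t (σ ω + pointOne)
          * sqSum (fourier φ) (σ ω + pointOne) = 0) :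
    ∀ᵐ ω : G, ‖t (σ ω)‖ ^ 2 * sqSum (fourier φ) (σ ω) +
        ‖t (σ ω + pointOne)‖ ^ 2 * sqSum (fourier φ) (σ ω + pointOne) = 0 := by
  obtain ⟨g, -, hg⟩ := hV.exists_hasSymbol htm ht hC
  have hgW := (hV.mem_wavelet_iff hm hg).2 h1
  have hbr : bracket (fourier ψ) (fourier g) =ᵐ[(volume : Measure G).restrict (D : Set G)] 0 := by
    filter_upwards [h2, ae_restrict_of_ae (hr.bracket_eq hg)] with ω e1 e2
    rw [e2, e1, Pi.zero_apply]
  have hg0 : g = 0 := hψ.eq_zero hgW fun n => inner_T_eq_zero_of_bracket hbr n.2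
  have hF : fourier g =ᵐ[volume] fun _ => (0 : ℂ) := by
    rw [hg0, map_zero]
    exact Lp.coeFn_zero _ _ _
  filter_upwards [hg.sqSum_eq, sqSum_congr hF] with ω e1 e2
  rw [← e1, e2]
  simp [sqSum]

/-- On the bad set `B` every vector lies in the fibre of `W₀`. A test vector perpendicular to that
of `ψ` shows first that the symbol of `ψ` vanishes on `B`; then any vector is perpendicular to it,
and the constant symbol `1` on `B` shows that `B` is negligible. -/
theorem not_both_zero_of_isFrameFor (hV : IsFMRA V φ) (hm : IsFilter φ m) {ψ : L2}
    (hψW : ψ ∈ V 1) (hψ : IsFrameFor (fun n : Lam => T n ψ) (V 1 ⊓ (V 0)ᗮ)) :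
    ∀ᵐ ω : G, sqSum (fourier φ) (σ ω) ≠ 0 → sqSum (fourier φ) (σ ω + pointOne) ≠ 0 →
      ¬(m (σ ω) = 0 ∧ m (σ ω + pointOne) = 0) := by
  classical
  obtain ⟨r, hr⟩ := hV.hasSymbol_of_mem hψW
  obtain ⟨a, b, ha, hab, hbd⟩ := hV.exists_bounds
  set Φ := sqSum (fourier φ)
  have hΦm : Measurable Φ := measurable_sqSum (measurable_coe _)
  have hΦp : IsPeriodic Φ := isPeriodic_sqSum _
  have hΦ0 (ω : G) : 0 ≤ Φ ω := sqSum_nonneg _ _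
  have hb : 0 < b := ha.trans_le hab
  have hΦb : ∀ᵐ ω : G, Φ ω ≤ b := hbd.mono fun ω h => h.elim (fun h => h.trans_le hb.le) And.right
  set B : Set G := {ω | (Φ ω ≠ 0 ∧ Φ (ω + pointOne) ≠ 0) ∧ m ω = 0 ∧ m (ω + pointOne) = 0}
  have hmm : Measurable fun ω => m (ω + pointOne) := hm.1.comp (measurable_add_right _)
  have hΦm' : Measurable fun ω => Φ (ω + pointOne) := hΦm.comp (measurable_add_right _)
  have hrm' : Measurable fun ω => r (ω + pointOne) := hr.1.comp (measurable_add_right _)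
  have hBm : MeasurableSet B :=
    ((hΦm (measurableSet_singleton 0).compl).inter (hΦm' (measurableSet_singleton 0).compl)).inter
      ((hm.1 (measurableSet_singleton 0)).inter (hmm (measurableSet_singleton 0)))
  have hBp (ω n : G) (hn : n ∈ Lam) : ω + n ∈ B ↔ ω ∈ B := by
    simp only [B, Set.mem_ofPred_eq, hΦp _ n hn, hm.2.1 _ n hn, add_right_comm ω n pointOne]
  have hB1 (ω : G) : ω + pointOne ∈ B ↔ ω ∈ B := by
    simp only [B, Set.mem_ofPred_eq, add_pointOne_add_pointOne]
    tauto
  -- The weighted perpendicular of the symbol of `ψ`; `χ (single 0)` supplies the opposite signs at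
  -- `ω` and `ω + 0.1`. The denominator takes the same value at both points and bounds `u` by `Φ (ω
  -- + 0.1)`, so that `u` is an admissible symbol.
  set u : G → ℂ := fun ω => χ (single 0) ω * starRingEnd ℂ (r (ω + pointOne)) * Φ (ω + pointOne) /
    ((1 + ‖r ω‖ + ‖r (ω + pointOne)‖ : ℝ) : ℂ)
  have hum : Measurable u := by
    refine Measurable.div ((Measurable.mul (continuous_χ_right _).measurable
      (Complex.continuous_conj.measurable.comp hrm')).mul
      (Complex.measurable_ofReal.comp hΦm')) (Complex.measurable_ofReal.comp ?_)
    exact (measurable_const.add hr.1.norm).add hrm'.norm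
  have hup : IsPeriodic u := fun ω n hn => by
    simp only [u, add_right_comm ω n pointOne, hΦp _ n hn, hr.2.1 _ n hn,
      isPeriodic_χ (single_mem_Lam le_rfl) _ n hn]
  have hunorm (ω : G) : ‖u ω‖ ≤ Φ (ω + pointOne) := by
    have hpos : 0 < 1 + ‖r ω‖ + ‖r (ω + pointOne)‖ := by positivity
    simp only [u]
    rw [norm_div, norm_mul, norm_mul, norm_χ, one_mul, RCLike.norm_conj, Complex.norm_real,
      Complex.norm_real, Real.norm_of_nonneg (hΦ0 _), Real.norm_of_nonneg hpos.le,
      div_le_iff₀ hpos, mul_comm]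
    exact mul_le_mul_of_nonneg_left (by linarith [norm_nonneg (r ω)]) (hΦ0 _)
  have hind {t : G → ℂ} (ht : IsPeriodic t) : IsPeriodic (B.indicator t) := fun ω n hn => by
    by_cases h : ω ∈ B
    · rw [Set.indicator_of_mem h, Set.indicator_of_mem ((hBp ω n hn).2 h), ht ω n hn]
    · rw [Set.indicator_of_notMem h, Set.indicator_of_notMem (mt (hBp ω n hn).1 h)]
  have hmB (t : G → ℂ) : ∀ ω, starRingEnd ℂ (m ω) * B.indicator t ω * Φ ω +
      starRingEnd ℂ (m (ω + pointOne)) * B.indicator t (ω + pointOne) * Φ (ω + pointOne) = 0 := by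
    intro ω
    by_cases h : ω ∈ B
    · rw [h.2.1, h.2.2]
      simp
    · rw [Set.indicator_of_notMem h, Set.indicator_of_notMem (mt (hB1 ω).1 h)]
      simp
  have step1 := hV.symbol_eq_zero hm hψ hr (hum.indicator hBm) (hind hup) (C := b ^ 2 * b) (by
      filter_upwards [hΦb, ae_add_right hΦb pointOne] with ω h1 h2
      have h3 : ‖B.indicator u ω‖ ≤ b := (norm_indicator_le_norm_self _ _).trans
        ((hunorm ω).trans h2)
      have := hΦ0 ω
      gcongr)
    (.of_forall fun ω => hmB u (σ ω))
    (.of_forall fun ω => by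
      by_cases h : σ ω ∈ B
      · rw [Set.indicator_of_mem h, Set.indicator_of_mem ((hB1 _).2 h)]
        simp only [u, add_pointOne_add_pointOne, χ_single_zero_add_pointOne]
        rw [add_right_comm (1 : ℝ) ‖r (σ ω + pointOne)‖]
        ring
      · rw [Set.indicator_of_notMem h, Set.indicator_of_notMem (mt (hB1 _).1 h)]
        simp)
  have hr0 : ∀ᵐ ω : G, σ ω ∈ B → r (σ ω) = 0 ∧ r (σ ω + pointOne) = 0 := by
    filter_upwards [step1] with ω h hB
    rw [Set.indicator_of_mem hB, Set.indicator_of_mem ((hB1 _).2 hB)] at h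
    have e0 : 0 ≤ ‖u (σ ω)‖ ^ 2 * Φ (σ ω) := mul_nonneg (by positivity) (hΦ0 _)
    have e1 : 0 ≤ ‖u (σ ω + pointOne)‖ ^ 2 * Φ (σ ω + pointOne) :=
      mul_nonneg (by positivity) (hΦ0 _)
    have z0 : u (σ ω) = 0 := by
      have : ‖u (σ ω)‖ ^ 2 * Φ (σ ω) = 0 := by linarith
      simpa [hB.1.1] using this
    have z1 : u (σ ω + pointOne) = 0 := by
      have : ‖u (σ ω + pointOne)‖ ^ 2 * Φ (σ ω + pointOne) = 0 := by linarith
      simpa [hB.1.2] using this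
    have hχ (x : G) : χ (single 0) x ≠ 0 := fun hx => by simpa [hx] using norm_χ (single 0) x
    have hden (x y : ℂ) : ((1 + ‖x‖ + ‖y‖ : ℝ) : ℂ) ≠ 0 := by
      have : 0 < 1 + ‖x‖ + ‖y‖ := by positivity
      exact_mod_cast this.ne'
    have hc0 : (Φ (σ ω) : ℂ) ≠ 0 := by exact_mod_cast hB.1.1
    have hc1 : (Φ (σ ω + pointOne) : ℂ) ≠ 0 := by exact_mod_cast hB.1.2
    simp only [u, add_pointOne_add_pointOne, div_eq_zero_iff, mul_eq_zero, hχ, hden, hc0, hc1,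
      false_or, or_false, map_eq_zero] at z0 z1
    exact ⟨z1, z0⟩
  have step2 := hV.symbol_eq_zero hm hψ hr ((measurable_const (a := (1 : ℂ))).indicator hBm)
    (hind fun _ _ _ => rfl) (C := b) (by
      filter_upwards [hΦb] with ω h1
      have h3 : ‖B.indicator (fun _ => (1 : ℂ)) ω‖ ≤ 1 := by
        simpa using norm_indicator_le_norm_self (s := B) (fun _ => (1 : ℂ)) ω
      calc _ ≤ (1 : ℝ) ^ 2 * b := by
            have := hΦ0 ω
            gcongr
        _ = b := by ring)
    (.of_forall fun ω => hmB _ (σ ω))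
    (ae_restrict_of_ae (by
      filter_upwards [hr0] with ω h0
      by_cases h : σ ω ∈ B
      · rw [(h0 h).1, (h0 h).2]
        simp
      · rw [Set.indicator_of_notMem h, Set.indicator_of_notMem (mt (hB1 _).1 h)]
        simp))
  filter_upwards [step2] with ω h hn0 hn1 hm0
  have hB : σ ω ∈ B := ⟨⟨hn0, hn1⟩, hm0⟩
  rw [Set.indicator_of_mem hB, Set.indicator_of_mem ((hB1 _).2 hB)] at h
  simp only [norm_one, one_pow, one_mul] at h
  have h2 : Φ (σ ω) = 0 := by linarith [hΦ0 (σ ω), hΦ0 (σ ω + pointOne)]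
  exact hn0 h2

theorem exists_isFrameFor (hV : IsFMRA V φ) (hm : IsFilter φ m)
    (h : ∀ᵐ ω : G, ω ∈ D → sqSum (fourier φ) (σ ω) ≠ 0 →
      sqSum (fourier φ) (σ ω + pointOne) ≠ 0 → ¬(m (σ ω) = 0 ∧ m (σ ω + pointOne) = 0)) :
    ∃ ψ ∈ V 1 ⊓ (V 0)ᗮ, IsFrameFor (fun n : Lam => T n ψ) (V 1 ⊓ (V 0)ᗮ) := by
  classical
  obtain ⟨a, b, ha, hab, hbd⟩ := hV.exists_bounds
  set Φ := sqSum (fourier φ)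
  have hΦm : Measurable Φ := measurable_sqSum (measurable_coe _)
  have hΦp : IsPeriodic Φ := isPeriodic_sqSum _
  have hΦ0 (ω : G) : 0 ≤ Φ ω := sqSum_nonneg _ _
  have hb : 0 < b := ha.trans_le hab
  have hmm : Measurable fun ω => m (ω + pointOne) := hm.1.comp (measurable_add_right _)
  have hΦm' : Measurable fun ω => Φ (ω + pointOne) := hΦm.comp (measurable_add_right _)
  have hPbd : ∀ᵐ ω : G, ‖m (σ ω)‖ ^ 2 * Φ (σ ω) + ‖m (σ ω + pointOne)‖ ^ 2 * Φ (σ ω + pointOne) = 0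
      ∨ a ≤ ‖m (σ ω)‖ ^ 2 * Φ (σ ω) + ‖m (σ ω + pointOne)‖ ^ 2 * Φ (σ ω + pointOne) ∧
        ‖m (σ ω)‖ ^ 2 * Φ (σ ω) + ‖m (σ ω + pointOne)‖ ^ 2 * Φ (σ ω + pointOne) ≤ b := by
    filter_upwards [hm.sqSum_eq, hbd] with ω h1 h2
    rwa [← h1]
  set r : G → ℂ := fun ω => waveletSymbol (χ (single 0) ω) (m ω) (m (ω + pointOne)) (Φ ω)
    (Φ (ω + pointOne))
  have hrm : Measurable r := by
    refine Measurable.ite (hΦm (measurableSet_singleton 0)) measurable_const ?_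
    refine Measurable.ite (hΦm' (measurableSet_singleton 0))
      (Measurable.ite (hm.1 (measurableSet_singleton 0)) measurable_const measurable_const) ?_
    exact ((continuous_χ_right _).measurable.mul
      (Complex.continuous_conj.measurable.comp hmm)).mul (Complex.measurable_ofReal.comp hΦm')
  have hrp : IsPeriodic r := fun ω n hn => by
    simp only [r, add_right_comm ω n pointOne, hΦp _ n hn, hm.2.1 _ n hn,
      isPeriodic_χ (single_mem_Lam le_rfl) _ n hn]
  have hr1 (ω : G) : r (ω + pointOne) = waveletSymbol (-χ (single 0) ω) (m (ω + pointOne)) (m ω)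
      (Φ (ω + pointOne)) (Φ ω) := by
    simp only [r, add_pointOne_add_pointOne, χ_single_zero_add_pointOne]
  -- The term `b` covers fibres with one vanishing weight, where `|r| ≤ 1`; with both weights
  -- non-zero, `|r|² Φ(ω)` is a product of three factors at most `b`.
  have hC : ∀ᵐ ω : G, ‖r ω‖ ^ 2 * Φ ω ≤ b + b ^ 3 := by
    have h1 := (quasiMeasurePreserving_shift 1).ae hPbd
    simp only [σ_ρ] at h1
    have hΦb : ∀ᵐ ω : G, Φ ω ≤ b :=
      hbd.mono fun ω h => h.elim (fun h => h.trans_le hb.le) And.right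
    filter_upwards [h1, hΦb, ae_add_right hΦb pointOne] with ω e1 e2 e3
    have hnn := hΦ0 ω
    have hnn' := hΦ0 (ω + pointOne)
    have hb3 : 0 < b ^ 3 := by positivity
    by_cases h0 : Φ ω = 0
    · rw [h0, mul_zero]
      positivity
    by_cases h1 : Φ (ω + pointOne) = 0
    · have : ‖r ω‖ ≤ 1 := by
        simp only [r, waveletSymbol, h0, h1, if_true, if_false]
        split_ifs <;> simp
      calc ‖r ω‖ ^ 2 * Φ ω ≤ 1 ^ 2 * b := by gcongr
        _ ≤ b + b ^ 3 := by linarith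
    · have e4 : ‖m (ω + pointOne)‖ ^ 2 * Φ (ω + pointOne) ≤ b := by
        have : 0 ≤ ‖m ω‖ ^ 2 * Φ ω := by positivity
        rcases e1 with e1 | e1
        · linarith
        · linarith [e1.2]
      have e5 : ‖r ω‖ ^ 2 * Φ ω =
          ‖m (ω + pointOne)‖ ^ 2 * Φ (ω + pointOne) * Φ (ω + pointOne) * Φ ω := by
        simp only [r, waveletSymbol, h0, h1, if_false]
        rw [norm_mul, norm_mul, norm_χ, RCLike.norm_conj, Complex.norm_real,
          Real.norm_of_nonneg hnn']
        ring
      calc ‖r ω‖ ^ 2 * Φ ω ≤ b * b * b := by rw [e5]; gcongr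
        _ ≤ b + b ^ 3 := by nlinarith
  obtain ⟨ψ, -, hψ⟩ := hV.exists_hasSymbol hrm hrp hC
  have hψW : ψ ∈ V 1 ⊓ (V 0)ᗮ := (hV.mem_wavelet_iff hm hψ).2 (.of_forall fun ω => by
    rw [hr1]
    exact waveletSymbol_orthogonal _ _ _ _ _)
  refine ⟨ψ, hψW, hV.translate_mem_wavelet hψW, min a (a ^ 3), max b (b ^ 3),
    lt_min ha (by positivity), ?_, fun g hg => ?_⟩
  · exact (min_le_left _ _).trans (hab.trans (le_max_left _ _))
  obtain ⟨t, ht⟩ := hV.hasSymbol_of_mem hg.1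
  -- The fibre inequality; integrated over `D`, with Parseval on the bracket, it gives the frame
  -- bounds.
  have key : ∀ᵐ ω ∂(volume : Measure G).restrict (D : Set G),
      min a (a ^ 3) * sqSum (fourier g) ω ≤ ‖bracket (fourier ψ) (fourier g) ω‖ ^ 2 ∧
        ‖bracket (fourier ψ) (fourier g) ω‖ ^ 2 ≤ max b (b ^ 3) * sqSum (fourier g) ω := by
    filter_upwards [(hV.mem_wavelet_iff hm ht).1 hg, ae_restrict_of_ae (hψ.bracket_eq ht),
      ae_restrict_of_ae ht.sqSum_eq, ae_restrict_of_ae hPbd, ae_restrict_of_ae (ae_σ hbd),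
      ae_restrict_of_ae (ae_σ_add_pointOne hbd), ae_restrict_of_ae h,
      ae_restrict_mem (measurableSet_U 0)] with ω e1 e2 e3 e4 e5 e6 e7 e8
    rw [e2, e3, hr1]
    exact waveletSymbol_frame ha (norm_χ _ _) e5 e6 e4 (e7 e8) e1
  have hN := integrable_sqSum (Lp.memLp (fourier g))
  have hbm := (measurable_bracket (measurable_coe (fourier ψ))
    (measurable_coe (fourier g))).aestronglyMeasurable
    (μ := (volume : Measure G).restrict (D : Set G))
  have hint : Integrable (fun ω => ‖bracket (fourier ψ) (fourier g) ω‖ ^ 2)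
      ((volume : Measure G).restrict (D : Set G)) := by
    refine (hN.const_mul (max b (b ^ 3))).mono' (hbm.norm.pow 2) ?_
    filter_upwards [key] with ω e
    rw [Real.norm_of_nonneg (by positivity)]
    exact e.2
  have hsum := hasSum_inner_T ((memLp_two_iff_integrable_sq_norm hbm).2 hint)
  refine ⟨hsum.summable, ?_, ?_⟩
  · rw [hsum.tsum_eq, norm_sq_eq_integral_sqSum, ← integral_const_mul]
    exact integral_mono_ae (hN.const_mul _) hint (key.mono fun _ => And.left)
  · rw [hsum.tsum_eq, norm_sq_eq_integral_sqSum, ← integral_const_mul]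
    exact integral_mono_ae hint (hN.const_mul _) (key.mono fun _ => And.right)

/-- With both weights in `[a, b]`, the sum `P` lies between `a` and `b` times `|m(σω)|² +
|m(σω+0.1)|²`. Since `P` is non-zero, it also lies in `[a, b]`, which gives the constants `a / b`
and `b / a`. -/
theorem filter_bounds (hV : IsFMRA V φ) (hm : IsFilter φ m) : ∃ c d : ℝ, 0 < c ∧ 0 < d ∧
    ∀ᵐ ω : G, sqSum (fourier φ) (σ ω) ≠ 0 → sqSum (fourier φ) (σ ω + pointOne) ≠ 0 →
      ¬(m (σ ω) = 0 ∧ m (σ ω + pointOne) = 0) →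
      c ≤ ‖m (σ ω)‖ ^ 2 + ‖m (σ ω + pointOne)‖ ^ 2 ∧
        ‖m (σ ω)‖ ^ 2 + ‖m (σ ω + pointOne)‖ ^ 2 ≤ d := by
  obtain ⟨a, b, ha, hab, hbd⟩ := hV.exists_bounds
  have hb : 0 < b := ha.trans_le hab
  refine ⟨a / b, b / a, div_pos ha hb, div_pos hb ha, ?_⟩
  filter_upwards [hm.sqSum_eq, hbd, ae_σ hbd, ae_σ_add_pointOne hbd] with ω e h h0 h1 n0 n1 hmm
  obtain ⟨l0, u0⟩ := h0.resolve_left n0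
  obtain ⟨l1, u1⟩ := h1.resolve_left n1
  rw [e] at h
  have hlow : a * (‖m (σ ω)‖ ^ 2 + ‖m (σ ω + pointOne)‖ ^ 2) ≤
      ‖m (σ ω)‖ ^ 2 * sqSum (fourier φ) (σ ω) +
        ‖m (σ ω + pointOne)‖ ^ 2 * sqSum (fourier φ) (σ ω + pointOne) := by
    rw [mul_add, mul_comm a, mul_comm a]
    gcongr
  have hhigh : ‖m (σ ω)‖ ^ 2 * sqSum (fourier φ) (σ ω) +
        ‖m (σ ω + pointOne)‖ ^ 2 * sqSum (fourier φ) (σ ω + pointOne) ≤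
      b * (‖m (σ ω)‖ ^ 2 + ‖m (σ ω + pointOne)‖ ^ 2) := by
    rw [mul_add, mul_comm b, mul_comm b]
    gcongr
  have hpos : 0 < ‖m (σ ω)‖ ^ 2 + ‖m (σ ω + pointOne)‖ ^ 2 := by
    by_cases h2 : m (σ ω) = 0
    · have h3 : m (σ ω + pointOne) ≠ 0 := fun h3 => hmm ⟨h2, h3⟩
      have := norm_pos_iff.2 h3
      positivity
    · have := norm_pos_iff.2 h2
      positivity
  obtain ⟨l, u⟩ := h.resolve_left (by nlinarith)
  constructor
  · rw [div_le_iff₀ hb]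
    linarith
  · rw [le_div_iff₀ ha]
    linarith

end IsFMRA

/-! ### Periodic measurable representatives -/

theorem continuous_trunc (l : ℤ) : Continuous (trunc l) := by
  refine continuous_iff_continuousAt.2 fun x => ?_
  refine ContinuousAt.congr (f := fun _ => trunc l x) continuousAt_const ?_
  filter_upwards [(isOpen_cylinder x l).mem_nhds fun _ _ => rfl] with y hy
  refine ext_coord fun j => ?_
  rw [trunc_apply, trunc_apply]
  split_ifs with h
  · exact (hy j h).symm
  · rfl

theorem trunc_add_Lam (ω : G) {n : G} (hn : n ∈ Lam) : trunc 0 (ω + n) = trunc 0 ω + n := by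
  refine ext_coord fun j => ?_
  rw [add_apply, trunc_apply, trunc_apply]
  split_ifs with h
  · rfl
  · rw [hn j (by omega), add_zero]

/-- `ω + trunc 0 ω` is the representative of `ω` in `D`; evaluating a measurable version of `m`
there gives exact periodicity. -/
theorem exists_periodic_measurable {m : G → ℂ}
    (hm : AEMeasurable m ((volume : Measure G).restrict (D : Set G)))
    (hper : ∀ n ∈ Lam, ∀ᵐ ω : G, m (ω + n) = m ω) :
    ∃ m' : G → ℂ, Measurable m' ∧ IsPeriodic m' ∧ m =ᵐ[volume] m' := by
  refine ⟨fun ω => hm.mk m (ω + trunc 0 ω), hm.measurable_mk.comp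
    (continuous_id.add (continuous_trunc 0)).measurable, fun ω n hn => ?_, ?_⟩
  · beta_reduce
    rw [trunc_add_Lam ω hn, add_add_add_comm, add_self, add_zero]
  · have h1 := (ae_restrict_iff' (measurableSet_U 0)).1 hm.ae_eq_mk
    have h2 : ∀ᵐ ω : G, ∀ n : Lam, m (ω + n) = m ω := ae_all_iff.2 fun n => hper n n.2
    filter_upwards [ae_add_Lam h1, h2] with ω e1 e2
    have e3 := e1 ⟨trunc 0 ω, trunc_mem_Lam ω⟩
      (mem_cylinder_iff_add.1 (self_mem_cylinder_trunc 0 ω))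
    rw [← e3, e2 ⟨trunc 0 ω, trunc_mem_Lam ω⟩]

end CantorDyadic

open CantorDyadic
theorem mainTheorem2
    (V : ℤ → Submodule ℂ L2) (φ : L2) (hV : IsFMRA V φ)
    (φhat : G → ℂ) (hφhat : IsFourierTransform φ φhat)
    (m : G → ℂ) (hm : MemLp m 2 ((volume : Measure G).restrict (D : Set G)))
    (hm_per : ∀ n ∈ Lam, ∀ᵐ ω : G, m (ω + n) = m ω)
    (hm_ref : ∀ᵐ ω : G, φhat (ρ ω) = m ω * φhat ω) :
    -- existence of a frame wavelet is equivalent to (i)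
    ((∃ ψ ∈ V 1 ⊓ (V 0)ᗮ, IsFrameFor (fun n : Lam => T n ψ) (V 1 ⊓ (V 0)ᗮ)) ↔
      ∀ᵐ ω : G, ω ∈ Delta2 φhat → ¬(m (σ ω) = 0 ∧ m (σ ω + pointOne) = 0)) ∧
    -- (i) is equivalent to (ii)
    ((∀ᵐ ω : G, ω ∈ Delta2 φhat → ¬(m (σ ω) = 0 ∧ m (σ ω + pointOne) = 0)) ↔
      ∃ c d : ℝ, 0 < c ∧ 0 < d ∧ ∀ᵐ ω : G, ω ∈ Delta2 φhat →
        c ≤ ‖m (σ ω)‖ ^ 2 + ‖m (σ ω + pointOne)‖ ^ 2 ∧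
          ‖m (σ ω)‖ ^ 2 + ‖m (σ ω + pointOne)‖ ^ 2 ≤ d) ∧
    -- every frame wavelet generates a frame of the whole space
    (∀ ψ ∈ V 1 ⊓ (V 0)ᗮ, IsFrameFor (fun n : Lam => T n ψ) (V 1 ⊓ (V 0)ᗮ) →
      IsFrameFor (affineSystem ψ) ⊤) := by
  have hcomplete : ∀ j, CompleteSpace (V j) := fun j => (hV.closed j).completeSpace_coe
  have hφ := fourier_eq_of_isFourierTransform hφhat
  obtain ⟨m', hm'm, hm'p, hmm'⟩ := exists_periodic_measurable hm.1.aemeasurable hm_per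
  -- Evaluated at `σ ω`, the refinement equation says that `φ`, as an element of `V 1`, has symbol
  -- `m'`.
  have hm' : IsFilter φ m' := by
    refine ⟨hm'm, hm'p, ?_⟩
    filter_upwards [ae_σ hm_ref, hφ, ae_σ hφ, ae_σ hmm'] with ω h1 h2 h3 h4
    rw [ρ_σ] at h1
    rw [h2, h1, h3, h4]
  have hΔ : ∀ᵐ ω : G, ω ∈ Delta2 φhat ↔ ω ∈ D ∧ sqSum (fourier φ) (σ ω) ≠ 0 ∧
      sqSum (fourier φ) (σ ω + pointOne) ≠ 0 := by
    have h := ae_sqSummable (Lp.memLp (fourier φ))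
    filter_upwards [Delta2_congr hφ, ae_σ h, ae_σ_add_pointOne h] with ω h1 h2 h3
    rw [← h1, mem_Delta2_iff h2 h3]
  refine ⟨⟨?_, fun h => hV.exists_isFrameFor hm' ?_⟩, ⟨fun h => ?_, ?_⟩, fun ψ _ hψ =>
    hV.isFrameFor_affineSystem hψ⟩
  · rintro ⟨ψ, hψW, hψ⟩
    filter_upwards [hV.not_both_zero_of_isFrameFor hm' hψW.1 hψ, hΔ, ae_σ hmm',
      ae_σ_add_pointOne hmm'] with ω h1 h2 h3 h4 h5
    rw [h3, h4]
    exact h1 (h2.1 h5).2.1 (h2.1 h5).2.2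
  · filter_upwards [h, hΔ, ae_σ hmm', ae_σ_add_pointOne hmm'] with ω h1 h2 h3 h4 hD n0 n1
    rw [← h3, ← h4]
    exact h1 (h2.2 ⟨hD, n0, n1⟩)
  · obtain ⟨c, d, hc, hd, hcd⟩ := hV.filter_bounds hm'
    refine ⟨c, d, hc, hd, ?_⟩
    filter_upwards [h, hΔ, ae_σ hmm', ae_σ_add_pointOne hmm', hcd] with ω h1 h2 h3 h4 h5 h6
    rw [h3, h4] at h1 ⊢
    exact h5 (h2.1 h6).2.1 (h2.1 h6).2.2 (h1 h6)
  · rintro ⟨c, d, hc, -, hcd⟩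
    filter_upwards [hcd] with ω h1 h2 h3
    have := (h1 h2).1
    rw [h3.1, h3.2] at this
    simp at this
    linarith
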